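/- Let $\mathcal X,\mathcal Y$ be finite alphabets, $\pi_{XY}$ a probability distribution on $\mathcal X\times\mathcal Y$, and $\pi_{X^nY^n}=\pi_{XY}^{n}$ its $n$-fold product. All logarithms are natural, and $|P-Q|=\frac12\sum_a|P(a)-Q(a)|$ is the total variation (TV) distance. Wyner's common information is $$C_{\mathsf{Wyner}}(X;Y)=\min_{P_{XYW}:\,P_{XY}=\pi_{XY},\,X-W-Y}I(XY;W),$$ over all finite alphabets of $W$ and all joint distributions with $XY$-marginal $\pi_{XY}$ for which $X-W-Y$ is a Markov chain (the minimum is attained). A synthesis code of block length $n$ consists of a non-empty message set $\mathcal M_n=\{1,\dots,|\mathcal M_n|\}$ and two random mappings $P_{X^n|M_n},P_{Y^n|M_n}$; it synthesizes the distribution $$P_{X^nY^n}(x^n,y^n)=\frac1{|\mathcal M_n|}\sum_{m\in\mathcal M_n}P_{X^n|M_n}(x^n|m)\,P_{Y^n|M_n}(y^n|m).$$ A sequence of synthesis codes has rate $R$ if $|\mathcal M_n|=\lfloor e^{nR}\rfloor$ for all $n$. For $\varepsilon\in[0,1]$ let $T^{\mathsf{TV}}_\varepsilon(\pi_{XY})$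 be the infimum of the rates $R>0$ for which there is a sequence of synthesis codes of rate $R$ with $\limsup_{n\to\infty}|P_{X^nY^n}-\pi_{X^nY^n}|\le\varepsilon$. Then the following hold. (i) $T^{\mathsf{TV}}_\varepsilon(\pi_{XY})=C_{\mathsf{Wyner}}(X;Y)$ for every $\varepsilon\in[0,1)$, and $T^{\mathsf{TV}}_1(\pi_{XY})=0$. Hence the strong converse property holds: $T^{\mathsf{TV}}_\varepsilon(\pi_{XY})$ does not depend on $\varepsilon\in[0,1)$. (ii) For every $R>C_{\mathsf{Wyner}}(X;Y)$ there is a sequence of synthesis codes of rate $R$ for which $|P_{X^nY^n}-\pi_{X^nY^n}|$ tends to zero exponentially fast: for some $\delta>0$, $|P_{X^nY^n}-\pi_{X^nY^n}|\le e^{-n\delta}$ for all sufficiently large $n$. (iii) For every $R<C_{\mathsf{Wyner}}(X;Y)$ and every sequence of synthesis codes with $\frac1n\log|\mathcal M_n|\le R$ for all sufficiently large $n$ (in particular, every sequence of rate $R$), $|P_{X^nY^n}-\pi_{X^nY^n}|$ tends to one exponentially fast: for some $\delta>0$, $|P_{X^nY^n}-\pi_{X^nY^n}|\ge1-e^{-n\delta}$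 for all sufficiently large $n$. -/

import Mathlib

open Filter

noncomputable section

/-- The total variation distance `(1/2) ∑ₐ |P(a) - Q(a)|` of two probability mass functions on a
finite alphabet. -/
def tvDist {α : Type*} [Fintype α] (P Q : α → ℝ) : ℝ :=
  (1 / 2) * ∑ a, |P a - Q a|

section SingleLetter

variable {X Y W : Type*} [Fintype X] [Fintype Y] [Fintype W]

/-- The marginal `P_{XY}` of a joint mass function `P_{XYW}`. -/
def margXY (P : X × Y × W → ℝ) (x : X) (y : Y) : ℝ := ∑ w, P (x, y, w)

/-- The marginal `P_{XW}` of a joint mass function `P_{XYW}`. -/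
def margXW (P : X × Y × W → ℝ) (x : X) (w : W) : ℝ := ∑ y, P (x, y, w)

/-- The marginal `P_{YW}` of a joint mass function `P_{XYW}`. -/
def margYW (P : X × Y × W → ℝ) (y : Y) (w : W) : ℝ := ∑ x, P (x, y, w)

/-- The marginal `P_W` of a joint mass function `P_{XYW}`. -/
def margW (P : X × Y × W → ℝ) (w : W) : ℝ := ∑ x, ∑ y, P (x, y, w)

/-- The Markov chain `X - W - Y`: given `W`, the variables `X` and `Y` are independent, that is,
`P(x,y,w) P(w) = P(x,w) P(y,w)`. -/
def IsMarkovXWY (P : X × Y × W → ℝ) : Prop :=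
  ∀ x y w, P (x, y, w) * margW P w = margXW P x w * margYW P y w

/-- The mutual information `I(XY; W) = D(P_{XYW} ‖ P_{XY} P_W)`, in nats. A summand with
`P(x,y,w) = 0` vanishes; in every other summand the denominator is positive. -/
def mutualInfoXYW (P : X × Y × W → ℝ) : ℝ :=
  ∑ x, ∑ y, ∑ w, P (x, y, w) * Real.log (P (x, y, w) / (margXY P x y * margW P w))

end SingleLetter

/-- The values `I(XY; W)` over all finite alphabets of `W` (up to relabelling, `Fin k`) and all
joint distributions `P_{XYW}` with `P_{XY} = π` and `X - W - Y`. -/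
def wynerValues {X Y : Type*} [Fintype X] [Fintype Y] (π : X × Y → ℝ) : Set ℝ :=
  {I | ∃ (k : ℕ) (P : X × Y × Fin k → ℝ), P ∈ stdSimplex ℝ (X × Y × Fin k) ∧
    (∀ x y, margXY P x y = π (x, y)) ∧ IsMarkovXWY P ∧ mutualInfoXYW P = I}

/-- Wyner's common information `C_Wyner(X; Y)` of the distribution `π`. -/
def wynerCI {X Y : Type*} [Fintype X] [Fintype Y] (π : X × Y → ℝ) : ℝ :=
  sInf (wynerValues π)

/-- A synthesis code of block length `n`: a non-empty message set `{1, …, |M_n|}` and two random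
mappings `P_{X^n|M_n}` and `P_{Y^n|M_n}`. -/
structure SynthesisCode (X Y : Type*) [Fintype X] [Fintype Y] (n : ℕ) where
  /-- The number `|M_n|` of messages. -/
  numMessages : ℕ
  numMessages_pos : 0 < numMessages
  /-- `encX m x` is `P_{X^n|M_n}(x | m)`. -/
  encX : Fin numMessages → (Fin n → X) → ℝ
  encX_mem : ∀ m, encX m ∈ stdSimplex ℝ (Fin n → X)
  /-- `encY m y` is `P_{Y^n|M_n}(y | m)`. -/
  encY : Fin numMessages → (Fin n → Y) → ℝ
  encY_mem : ∀ m, encY m ∈ stdSimplex ℝ (Fin n → Y)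

section Codes

variable {X Y : Type*} [Fintype X] [Fintype Y]

/-- The synthesized distribution `P_{X^n Y^n}`, the message being uniformly distributed. -/
def SynthesisCode.inducedDist {n : ℕ} (c : SynthesisCode X Y n) :
    (Fin n → X) × (Fin n → Y) → ℝ :=
  fun z => (1 / (c.numMessages : ℝ)) * ∑ m, c.encX m z.1 * c.encY m z.2

/-- The `n`-fold product distribution `π^n`. -/
def productDist (π : X × Y → ℝ) (n : ℕ) : (Fin n → X) × (Fin n → Y) → ℝ :=
  fun z => ∏ i, π (z.1 i, z.2 i)

/-- The distance `|P_{X^n Y^n} - π_{X^n Y^n}|` achieved by a code. -/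
def SynthesisCode.tvError {n : ℕ} (c : SynthesisCode X Y n) (π : X × Y → ℝ) : ℝ :=
  tvDist c.inducedDist (productDist π n)

/-- A sequence of codes has rate `R` if `|M_n| = e^{nR}` for all `n`, rounded down to an
integer. -/
def HasRate (c : (n : ℕ) → SynthesisCode X Y n) (R : ℝ) : Prop :=
  ∀ n : ℕ, (c n).numMessages = ⌊Real.exp (n * R)⌋₊

/-- The rates `R > 0` for which some sequence of codes of rate `R` has a TV distance that is
asymptotically at most `ε`. -/
def achievableRatesTV (π : X × Y → ℝ) (ε : ℝ) : Set ℝ :=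
  {R | 0 < R ∧ ∃ c : (n : ℕ) → SynthesisCode X Y n, HasRate c R ∧
    limsup (fun n => (c n).tvError π) atTop ≤ ε}

/-- The common information `T_ε^TV(π)` under the TV distance. -/
def commonInfoTV (π : X × Y → ℝ) (ε : ℝ) : ℝ :=
  sInf (achievableRatesTV π ε)

/-- The strong converse property: `T_ε^TV(π)` does not depend on `ε ∈ [0,1)`. -/
def StrongConverseTV (π : X × Y → ℝ) : Prop :=
  ∀ ε ∈ Set.Ico (0 : ℝ) 1, ∀ ε' ∈ Set.Ico (0 : ℝ) 1, commonInfoTV π ε = commonInfoTV π ε'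

end Codes

end

/-! Converse. Conditioning on `W` turns a joint law into a convex combination of points `(Q, H(Q),
I(Q))`. Their hull `infoSet` is compact, and Wyner's common information `C` is `H(π)` minus the
largest `h` with `(π, h, 0)` in it. For `R < C` the point `(π, H(π) - R, 0)` lies outside, and a
separating hyperplane gives a Lagrangian bound `E_Q φ - H(Q) + μ I(Q) ≥ c` with `μ ≥ 0` and a
positive gap at `π` (`exists_multipliers_of_lt_wynerCI`). The bound tensorizes, since the chain rule
is exact for `H` and `I` is superadditive (`nsmul_mul_sum_le`). It is applied to the overlap `min(P,
π^n)`, of mass `θ = 1 - TV`, split by message. Each piece lies below `1/M` times a product law, so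
the mutual informations total at most `θ log(1/θ)`; the entropies cost `log M`; an exponential
moment replaces typicality. Every error is a multiple of `log(1/θ)` (`nsmul_le_log_card_add`), so
`θ` must decay exponentially.

Achievability. Codewords are drawn i.i.d. from `P_W^n` for an optimal `W` and sent through its two
kernels. Truncating the likelihood ratio at `exp(n(C + 2η))` makes a variance bound effective
(`exists_codebook_tvDist_le`), and Chernoff's bound controls the truncated mass (`sum_atypical_le`).
-/

noncomputable section

/-! ### Entropy and mutual information of unnormalised measures -/

section Entropy

open Real

variable {ι α β : Type*} [Fintype ι] [Fintype α] [Fintype β]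

/-- The log-sum inequality. -/
theorem sum_mul_log_sub_log_le {x t : ι → ℝ} {T : ℝ} (hx : ∀ i, 0 ≤ x i) (ht : ∀ i, 0 ≤ t i)
    (hxt : ∀ i, t i = 0 → x i = 0) (hT : ∑ i, t i ≤ T) :
    ∑ i, x i * (log (t i) - log (x i)) ≤ (∑ i, x i) * (log T - log (∑ i, x i)) := by
  rcases (Finset.sum_nonneg fun i _ => hx i).eq_or_lt with h0 | hX
  · have h : ∀ i, x i = 0 := fun i =>
      (Finset.sum_eq_zero_iff_of_nonneg fun i _ => hx i).1 h0.symm i (Finset.mem_univ i)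
    simp [h]
  have hTpos : 0 < T := by
    obtain ⟨i, -, hi⟩ := Finset.exists_lt_of_sum_lt (s := Finset.univ) (f := fun _ : ι => (0 : ℝ))
      (g := x) (by simpa using hX)
    have : t i ≠ 0 := fun h => hi.ne' (hxt i h)
    exact ((lt_of_le_of_ne (ht i) this.symm).trans_le
      (Finset.single_le_sum (fun i _ => ht i) (Finset.mem_univ i))).trans_le hT
  set S := ∑ i, x i with hS
  -- This is `log y ≤ y - 1` at `y = t i * S / (T * x i)`; the linear corrections sum to at most
  -- zero because `∑ t ≤ T`.
  have key : ∀ i, x i * (log (t i) - log (x i)) ≤ x i * (log T - log S) + (t i * S / T - x i) := by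
    intro i
    rcases (hx i).eq_or_lt with h | h
    · rw [← h]
      have := mul_nonneg (ht i) hX.le
      have := div_nonneg this hTpos.le
      simpa using this
    · have hti : 0 < t i := lt_of_le_of_ne (ht i) fun h' => h.ne' (hxt i h'.symm)
      have h1 : log (t i * S / (T * x i)) ≤ t i * S / (T * x i) - 1 :=
        log_le_sub_one_of_pos (by positivity)
      rw [log_div (by positivity) (by positivity), log_mul hti.ne' hX.ne',
        log_mul hTpos.ne' h.ne'] at h1
      have h2 := mul_le_mul_of_nonneg_left h1 h.le
      have h3 : x i * (t i * S / (T * x i) - 1) = t i * S / T - x i := by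
        field_simp
      rw [h3] at h2
      linarith
  calc ∑ i, x i * (log (t i) - log (x i))
      ≤ ∑ i, (x i * (log T - log S) + (t i * S / T - x i)) :=
        Finset.sum_le_sum fun i _ => key i
    _ = S * (log T - log S) + ((∑ i, t i) * S / T - S) := by
        rw [Finset.sum_add_distrib, Finset.sum_sub_distrib, ← Finset.sum_mul, ← Finset.sum_div,
          ← Finset.sum_mul]
    _ ≤ S * (log T - log S) := by
        have : (∑ i, t i) * S / T ≤ S := by
          rw [div_le_iff₀ hTpos, mul_comm S]
          exact mul_le_mul_of_nonneg_right hT hX.le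
        linarith

/-- The Shannon entropy of a finite measure, extended to be homogeneous of degree one. -/
def homEntropy (q : α → ℝ) : ℝ := ∑ a, negMulLog (q a) - negMulLog (∑ a, q a)

theorem homEntropy_eq (q : α → ℝ) :
    homEntropy q = ∑ a, q a * (log (∑ b, q b) - log (q a)) := by
  simp only [homEntropy, negMulLog, mul_sub, Finset.sum_sub_distrib, ← Finset.sum_mul, neg_mul,
    Finset.sum_neg_distrib]
  ring

theorem homEntropy_smul (t : ℝ) (q : α → ℝ) :
    homEntropy (fun a => t * q a) = t * homEntropy q := by
  simp only [homEntropy, negMulLog_mul, Finset.sum_add_distrib, ← Finset.mul_sum, ← Finset.sum_mul]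
  ring

theorem homEntropy_of_sum_eq_one {q : α → ℝ} (h : ∑ a, q a = 1) :
    homEntropy q = ∑ a, negMulLog (q a) := by
  simp [homEntropy, h]

theorem homEntropy_comp_equiv (e : α ≃ β) (q : β → ℝ) : homEntropy (q ∘ e) = homEntropy q := by
  simp only [homEntropy, Function.comp_apply]
  rw [e.sum_comp q, e.sum_comp fun b => negMulLog (q b)]

/-- The chain rule for the entropy. -/
theorem homEntropy_prod (q : α × β → ℝ) :
    homEntropy q = homEntropy (fun a => ∑ b, q (a, b)) + ∑ a, homEntropy fun b => q (a, b) := by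
  simp only [homEntropy, Fintype.sum_prod_type, Finset.sum_sub_distrib]
  ring

/-- The homogeneous entropy is superadditive (the entropy is concave). -/
theorem sum_homEntropy_le {q : ι → α → ℝ} (hq : ∀ i a, 0 ≤ q i a) :
    ∑ i, homEntropy (q i) ≤ homEntropy fun a => ∑ i, q i a := by
  simp only [homEntropy_eq]
  rw [Finset.sum_comm]
  refine Finset.sum_le_sum fun a _ => ?_
  refine sum_mul_log_sub_log_le (t := fun i => ∑ b, q i b) (fun i => hq i a)
    (fun i => Finset.sum_nonneg fun b _ => hq i b) (fun i hi => ?_) Finset.sum_comm.le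
  exact (Finset.sum_eq_zero_iff_of_nonneg fun b _ => hq i b).1 hi a (Finset.mem_univ a)

/-- The mutual information of the two coordinates, homogeneous of degree one. -/
def homMutualInfo (q : α × β → ℝ) : ℝ :=
  homEntropy (fun a => ∑ b, q (a, b)) + homEntropy (fun b => ∑ a, q (a, b)) - homEntropy q

theorem homMutualInfo_smul (t : ℝ) (q : α × β → ℝ) :
    homMutualInfo (fun z => t * q z) = t * homMutualInfo q := by
  simp only [homMutualInfo, ← Finset.mul_sum, homEntropy_smul]
  ring

theorem homMutualInfo_comp_equiv {α' β' : Type*} [Fintype α'] [Fintype β'] (e : α ≃ α')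
    (f : β ≃ β') (q : α' × β' → ℝ) :
    homMutualInfo (q ∘ e.prodCongr f) = homMutualInfo q := by
  simp only [homMutualInfo, homEntropy_comp_equiv]
  congr 2
  · rw [← homEntropy_comp_equiv e]
    congr 1
    funext a
    exact f.sum_comp fun b => q (e a, b)
  · rw [← homEntropy_comp_equiv f]
    congr 1
    funext a
    exact e.sum_comp fun b => q (b, f a)

/-- Superadditivity of the mutual information with conditioning on the first pair. -/
theorem homMutualInfo_prod_le {α' β' : Type*} [Fintype α'] [Fintype β']
    {q : (α × α') × (β × β') → ℝ} (hq : ∀ z, 0 ≤ q z) :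
    homMutualInfo (fun z : α × β => ∑ w : α' × β', q ((z.1, w.1), (z.2, w.2))) +
      ∑ z : α × β, homMutualInfo (fun w : α' × β' => q ((z.1, w.1), (z.2, w.2))) ≤
    homMutualInfo q := by
  -- The chain rule conditions `a'` on `a` only. Conditioning on `b` as well lowers the entropy by
  -- concavity, which is the sole loss: `hC` for the joint entropy is exact.
  have hA : homEntropy (fun a : α × α' => ∑ b, q (a, b)) ≥
      homEntropy (fun a : α => ∑ b : β, ∑ w : α' × β', q ((a, w.1), (b, w.2))) +
      ∑ z : α × β, homEntropy (fun a' : α' => ∑ b' : β', q ((z.1, a'), (z.2, b'))) := by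
    rw [homEntropy_prod]
    refine add_le_add (le_of_eq ?_) ?_
    · congr 1
      funext a
      simp only [Fintype.sum_prod_type]
      exact Finset.sum_comm
    · rw [Fintype.sum_prod_type]
      refine Finset.sum_le_sum fun a _ => ?_
      simp only [Fintype.sum_prod_type]
      exact sum_homEntropy_le fun b a' => Finset.sum_nonneg fun b' _ => hq _
  have hB : homEntropy (fun b : β × β' => ∑ a, q (a, b)) ≥
      homEntropy (fun b : β => ∑ a : α, ∑ w : α' × β', q ((a, w.1), (b, w.2))) +
      ∑ z : α × β, homEntropy (fun b' : β' => ∑ a' : α', q ((z.1, a'), (z.2, b'))) := by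
    rw [homEntropy_prod]
    refine add_le_add (le_of_eq ?_) ?_
    · congr 1
      funext b
      simp only [Fintype.sum_prod_type]
      symm
      rw [Finset.sum_comm]
      exact Finset.sum_congr rfl fun a _ => Finset.sum_comm
    · rw [Fintype.sum_prod_type, Finset.sum_comm]
      refine Finset.sum_le_sum fun a _ => ?_
      simp only [Fintype.sum_prod_type]
      exact sum_homEntropy_le fun b a' => Finset.sum_nonneg fun b' _ => hq _
  have hC : homEntropy q =
      homEntropy (fun z : α × β => ∑ w : α' × β', q ((z.1, w.1), (z.2, w.2))) +
      ∑ z : α × β, homEntropy (fun w : α' × β' => q ((z.1, w.1), (z.2, w.2))) := by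
    rw [← homEntropy_comp_equiv (Equiv.prodProdProdComm α β α' β') q, homEntropy_prod]
    rfl
  simp only [homMutualInfo, Finset.sum_sub_distrib, Finset.sum_add_distrib]
  linarith

/-- The mutual information is at most the divergence from any product measure. -/
theorem homMutualInfo_le {q : α × β → ℝ} {κ : ℝ} {u : α → ℝ} {v : β → ℝ} (hκ : 0 < κ)
    (hq : ∀ z, 0 ≤ q z) (hu : ∀ a, 0 ≤ u a) (hv : ∀ b, 0 ≤ v b) (hu1 : ∑ a, u a ≤ 1)
    (hv1 : ∑ b, v b ≤ 1) (hle : ∀ a b, q (a, b) ≤ κ * (u a * v b)) :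
    homMutualInfo q ≤ (∑ z, q z) * (log κ - log (∑ z, q z)) := by
  have hsupp : ∀ a b, u a = 0 ∨ v b = 0 → q (a, b) = 0 := by
    intro a b h
    refine le_antisymm ((hle a b).trans (le_of_eq ?_)) (hq _)
    rcases h with h | h <;> simp [h]
  -- Gibbs' inequality: the cross entropy relative to a subprobability `u` dominates the entropy,
  -- both at the mass of `q`.
  have hA : homEntropy (fun a => ∑ b, q (a, b)) ≤
      -∑ a, (∑ b, q (a, b)) * log (u a) := by
    have h := sum_mul_log_sub_log_le (x := fun a => ∑ b, q (a, b)) (t := u) (T := 1)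
      (fun a => Finset.sum_nonneg fun b _ => hq _) hu
      (fun a ha => Finset.sum_eq_zero fun b _ => hsupp a b (Or.inl ha)) hu1
    simp only [homEntropy, negMulLog, ← Fintype.sum_prod_type, mul_sub, Finset.sum_sub_distrib,
      neg_mul, Finset.sum_neg_distrib, log_one, mul_zero] at h ⊢
    linarith
  have hB : homEntropy (fun b => ∑ a, q (a, b)) ≤
      -∑ b, (∑ a, q (a, b)) * log (v b) := by
    have h := sum_mul_log_sub_log_le (x := fun b => ∑ a, q (a, b)) (t := v) (T := 1)
      (fun a => Finset.sum_nonneg fun b _ => hq _) hv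
      (fun b hb => Finset.sum_eq_zero fun a _ => hsupp a b (Or.inr hb)) hv1
    simp only [homEntropy, negMulLog, ← Fintype.sum_prod_type_right, mul_sub,
      Finset.sum_sub_distrib, neg_mul, Finset.sum_neg_distrib, log_one, mul_zero] at h ⊢
    linarith
  have hC : ∑ z, q z * log (q z) ≤ (∑ z, q z) * log κ + ∑ a, (∑ b, q (a, b)) * log (u a) +
      ∑ b, (∑ a, q (a, b)) * log (v b) := by
    have e1 : ∑ b, (∑ a, q (a, b)) * log (v b) = ∑ z : α × β, q z * log (v z.2) := by
      rw [Fintype.sum_prod_type_right]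
      simp only [Finset.sum_mul]
    have e2 : ∑ a, (∑ b, q (a, b)) * log (u a) = ∑ z : α × β, q z * log (u z.1) := by
      rw [Fintype.sum_prod_type]
      simp only [Finset.sum_mul]
    rw [e1, e2, Finset.sum_mul, ← Finset.sum_add_distrib, ← Finset.sum_add_distrib]
    refine Finset.sum_le_sum fun z _ => ?_
    rcases (hq z).eq_or_lt with h | h
    · simp [← h]
    · have hu' : u z.1 ≠ 0 := fun h' => h.ne' (hsupp z.1 z.2 (Or.inl h'))
      have hv' : v z.2 ≠ 0 := fun h' => h.ne' (hsupp z.1 z.2 (Or.inr h'))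
      have := log_le_log h (hle z.1 z.2)
      rw [log_mul hκ.ne' (mul_ne_zero hu' hv'), log_mul hu' hv'] at this
      have := mul_le_mul_of_nonneg_left this h.le
      linarith
  simp only [homMutualInfo]
  have hD : homEntropy q = -∑ z, q z * log (q z) + (∑ z, q z) * log (∑ z, q z) := by
    simp only [homEntropy, negMulLog, neg_mul, Finset.sum_neg_distrib]
    ring
  rw [hD]
  linarith

/-- The linear part of `klFun` cancels because `q` and the product of its marginals both have mass
one. Termwise nonnegativity then gives both the sign and the equality case. -/
theorem homMutualInfo_eq_sum_klFun {q : α × β → ℝ} (hq : ∀ z, 0 ≤ q z) (hq1 : ∑ z, q z = 1) :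
    homMutualInfo q = ∑ z : α × β, (∑ b, q (z.1, b)) * (∑ a, q (a, z.2)) *
      InformationTheory.klFun (q z / ((∑ b, q (z.1, b)) * (∑ a, q (a, z.2)))) := by
  set u : α → ℝ := fun a => ∑ b, q (a, b) with hu
  set v : β → ℝ := fun b => ∑ a, q (a, b) with hv
  have hu1 : ∑ a, u a = 1 := by rw [hu, ← Fintype.sum_prod_type, hq1]
  have hv1 : ∑ b, v b = 1 := by rw [hv, ← Fintype.sum_prod_type_right, hq1]
  have h1 : ∀ z : α × β, u z.1 * v z.2 * InformationTheory.klFun (q z / (u z.1 * v z.2)) =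
      q z * log (q z) - q z * log (u z.1) - q z * log (v z.2) + u z.1 * v z.2 - q z := by
    intro z
    have hqu : q z ≤ u z.1 :=
      Finset.single_le_sum (f := fun b => q (z.1, b)) (fun b _ => hq _) (Finset.mem_univ z.2)
    have hqv : q z ≤ v z.2 :=
      Finset.single_le_sum (f := fun a => q (a, z.2)) (fun b _ => hq _) (Finset.mem_univ z.1)
    rcases (hq z).eq_or_lt with h | h
    · simp [← h, InformationTheory.klFun]
    · have hu' : 0 < u z.1 := h.trans_le hqu
      have hv' : 0 < v z.2 := h.trans_le hqv
      rw [InformationTheory.klFun, log_div h.ne' (by positivity), log_mul hu'.ne' hv'.ne']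
      field_simp
      ring
  rw [Finset.sum_congr rfl fun z _ => h1 z]
  simp only [Finset.sum_sub_distrib, Finset.sum_add_distrib]
  have e1 : ∑ z : α × β, q z * log (v z.2) = ∑ b, v b * log (v b) := by
    rw [Fintype.sum_prod_type_right]
    simp only [hv, Finset.sum_mul]
  have e2 : ∑ z : α × β, q z * log (u z.1) = ∑ a, u a * log (u a) := by
    rw [Fintype.sum_prod_type]
    simp only [hu, Finset.sum_mul]
  have e3 : ∑ z : α × β, u z.1 * v z.2 = 1 := by
    rw [Fintype.sum_prod_type, ← Fintype.sum_mul_sum, hu1, hv1, one_mul]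
  rw [e1, e2, e3, hq1, homMutualInfo, homEntropy_of_sum_eq_one hu1, homEntropy_of_sum_eq_one hv1,
    homEntropy_of_sum_eq_one hq1]
  simp only [negMulLog, neg_mul, Finset.sum_neg_distrib]
  ring

theorem homMutualInfo_nonneg {q : α × β → ℝ} (hq : ∀ z, 0 ≤ q z) (hq1 : ∑ z, q z = 1) :
    0 ≤ homMutualInfo q := by
  rw [homMutualInfo_eq_sum_klFun hq hq1]
  refine Finset.sum_nonneg fun z _ => ?_
  have h1 : 0 ≤ ∑ b, q (z.1, b) := Finset.sum_nonneg fun b _ => hq _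
  have h2 : 0 ≤ ∑ a, q (a, z.2) := Finset.sum_nonneg fun b _ => hq _
  exact mul_nonneg (mul_nonneg h1 h2)
    (InformationTheory.klFun_nonneg (div_nonneg (hq z) (mul_nonneg h1 h2)))

/-- Every `klFun` term vanishes: either a marginal is zero, which forces `q` to be zero there, or
the ratio is one. -/
theorem eq_mul_of_homMutualInfo_eq_zero {q : α × β → ℝ} (hq : ∀ z, 0 ≤ q z)
    (hq1 : ∑ z, q z = 1) (h0 : homMutualInfo q = 0) (a : α) (b : β) :
    q (a, b) = (∑ b', q (a, b')) * ∑ a', q (a', b) := by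
  rw [homMutualInfo_eq_sum_klFun hq hq1] at h0
  have hu : ∀ a, 0 ≤ ∑ b, q (a, b) := fun a => Finset.sum_nonneg fun b _ => hq _
  have hv : ∀ b, 0 ≤ ∑ a, q (a, b) := fun b => Finset.sum_nonneg fun b _ => hq _
  have hdiv : ∀ z : α × β, 0 ≤ q z / ((∑ b, q (z.1, b)) * (∑ a, q (a, z.2))) := fun z =>
    div_nonneg (hq z) (mul_nonneg (hu _) (hv _))
  have h := (Finset.sum_eq_zero_iff_of_nonneg fun (z : α × β) _ =>
    mul_nonneg (mul_nonneg (hu z.1) (hv z.2)) (InformationTheory.klFun_nonneg (hdiv z))).1 h0 (a, b)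
    (Finset.mem_univ _)
  rcases mul_eq_zero.1 h with h | h
  · have hqu : q (a, b) ≤ ∑ b, q (a, b) :=
      Finset.single_le_sum (f := fun b => q (a, b)) (fun b _ => hq _) (Finset.mem_univ b)
    have hqv : q (a, b) ≤ ∑ a, q (a, b) :=
      Finset.single_le_sum (f := fun a => q (a, b)) (fun b _ => hq _) (Finset.mem_univ a)
    simp only at h
    rw [h]
    refine le_antisymm ?_ (hq _)
    rcases mul_eq_zero.1 h with h | h
    · exact hqu.trans h.le
    · exact hqv.trans h.le
  · rw [InformationTheory.klFun_eq_zero_iff (hdiv _)] at h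
    exact eq_of_div_eq_one h

end Entropy

/-! ### Compactness of convex hulls by Carathéodory's theorem -/

section CompactHull

/-- In finite dimension, the convex hull of a compact set is compact. -/
theorem isCompact_convexHull_of_finiteDimensional {E : Type*} [NormedAddCommGroup E]
    [NormedSpace ℝ E] [FiniteDimensional ℝ E] {s : Set E} (hs : IsCompact s) :
    IsCompact (convexHull ℝ s) := by
  rcases s.eq_empty_or_nonempty with rfl | ⟨x₀, hx₀⟩
  · simp
  set d := Module.finrank ℝ E + 1
  have hcomp : IsCompact (stdSimplex ℝ (Fin d) ×ˢ Set.univ.pi fun _ : Fin d => s) :=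
    (isCompact_stdSimplex ℝ (Fin d)).prod (isCompact_univ_pi fun _ => hs)
  have hcont : Continuous fun v : (Fin d → ℝ) × (Fin d → E) => ∑ i, v.1 i • v.2 i := by
    fun_prop
  convert hcomp.image hcont using 1
  ext x
  constructor
  · intro hx
    obtain ⟨ι, _, z, w, hz, hz', hw, hw1, rfl⟩ := eq_pos_convex_span_of_mem_convexHull hx
    have hcard : Fintype.card ι ≤ Fintype.card (Fin d) := by
      rw [Fintype.card_fin]
      exact hz'.card_le_finrank_succ.trans (Nat.succ_le_succ (Submodule.finrank_le _))
    obtain ⟨e⟩ := Function.Embedding.nonempty_of_card_le hcard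
    -- Shorter combinations are padded to exactly `d` terms, with weight zero at the dummy point
    -- `x₀`.
    have hext : ∀ g : ι → E, ∑ j, Function.extend e w 0 j • Function.extend e g (fun _ => x₀) j =
        ∑ i, w i • g i := by
      intro g
      rw [← Finset.sum_subset (Finset.subset_univ (Finset.univ.map e))]
      · simp [e.injective.extend_apply]
      · intro j _ hj
        rw [Function.extend_apply', Pi.zero_apply, zero_smul]
        simpa using hj
    have hext1 : ∑ j, Function.extend e w 0 j = 1 := by
      rw [← hw1, ← Finset.sum_subset (Finset.subset_univ (Finset.univ.map e))]
      · simp [e.injective.extend_apply]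
      · intro j _ hj
        rw [Function.extend_apply', Pi.zero_apply]
        simpa using hj
    refine ⟨(Function.extend e w 0, Function.extend e z fun _ => x₀), ⟨⟨fun j => ?_, hext1⟩, ?_⟩,
      hext z⟩
    · by_cases hj : ∃ i, e i = j
      · obtain ⟨i, rfl⟩ := hj
        simpa [e.injective.extend_apply] using (hw i).le
      · simp [Function.extend_apply' _ _ _ hj]
    · intro j _
      by_cases hj : ∃ i, e i = j
      · obtain ⟨i, rfl⟩ := hj
        simpa [e.injective.extend_apply] using hz ⟨i, rfl⟩
      · simpa [Function.extend_apply' _ _ _ hj] using hx₀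
  · rintro ⟨⟨w, z⟩, ⟨⟨hw, hw1⟩, hz⟩, rfl⟩
    exact mem_convexHull_of_exists_fintype w z hw hw1 (fun i => hz i (Set.mem_univ i)) rfl

end CompactHull

/-! ### The convex-geometric form of Wyner's common information -/

section InfoSet

open Real (log negMulLog log_div log_mul)

variable {X Y : Type*} [Fintype X] [Fintype Y]

/-- A distribution on `X × Y` together with its entropy and its mutual information. -/
def infoPoint (Q : X × Y → ℝ) : (X × Y → ℝ) × ℝ × ℝ := (Q, homEntropy Q, homMutualInfo Q)

variable (X Y) in
/-- The triples `(P_{XY}, H(XY|W), I(X;Y|W))` for all `P_{XYW}`. -/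
def infoSet : Set ((X × Y → ℝ) × ℝ × ℝ) := convexHull ℝ (infoPoint '' stdSimplex ℝ (X × Y))

theorem isCompact_infoSet : IsCompact (infoSet X Y) := by
  refine isCompact_convexHull_of_finiteDimensional ((isCompact_stdSimplex ℝ (X × Y)).image ?_)
  unfold infoPoint homMutualInfo homEntropy
  fun_prop

/-- Comparison with the product of its own marginals, at `κ = 1` and mass one, leaves zero as the
upper bound. -/
theorem homMutualInfo_eq_zero_of_mul {Q : X × Y → ℝ} (hQ : Q ∈ stdSimplex ℝ (X × Y))
    (h : ∀ x y, Q (x, y) = (∑ y', Q (x, y')) * ∑ x', Q (x', y)) : homMutualInfo Q = 0 := by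
  refine le_antisymm ?_ (homMutualInfo_nonneg hQ.1 hQ.2)
  have h1 := homMutualInfo_le (q := Q) (κ := 1) (u := fun x => ∑ y, Q (x, y))
    (v := fun y => ∑ x, Q (x, y)) one_pos hQ.1 (fun x => Finset.sum_nonneg fun y _ => hQ.1 _)
    (fun y => Finset.sum_nonneg fun x _ => hQ.1 _) (by rw [← Fintype.sum_prod_type, hQ.2])
    (by rw [← Fintype.sum_prod_type_right, hQ.2]) (fun x y => by rw [one_mul]; exact (h x y).le)
  simpa [hQ.2] using h1

/-- By homogeneity the entropies of the slices add up to `H(XY|W)`, so this is `I(XY;W) = H(XY) -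
H(XY|W)`. -/
theorem mutualInfoXYW_eq {W : Type*} [Fintype W] {π : X × Y → ℝ} {P : X × Y × W → ℝ}
    (hP : ∀ z, 0 ≤ P z) (hm : ∀ x y, margXY P x y = π (x, y)) :
    mutualInfoXYW P = ∑ z, negMulLog (π z) - ∑ w, homEntropy fun z : X × Y => P (z.1, z.2, w) := by
  have h1 : ∀ x y w, P (x, y, w) * log (P (x, y, w) / (margXY P x y * margW P w)) =
      -(P (x, y, w) * log (π (x, y))) -
        P (x, y, w) * (log (∑ z : X × Y, P (z.1, z.2, w)) - log (P (x, y, w))) := by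
    intro x y w
    rw [hm]
    rcases (hP (x, y, w)).eq_or_lt with h | h
    · simp [← h]
    · have h2 : 0 < π (x, y) := by
        rw [← hm]
        exact h.trans_le (Finset.single_le_sum (f := fun w => P (x, y, w)) (fun w _ => hP _)
          (Finset.mem_univ w))
      have h3 : 0 < margW P w := by
        rw [margW, ← Fintype.sum_prod_type' (f := fun x y => P (x, y, w))]
        exact h.trans_le (Finset.single_le_sum (f := fun z : X × Y => P (z.1, z.2, w))
          (fun z _ => hP _) (Finset.mem_univ (x, y)))
      rw [log_div h.ne' (by positivity), log_mul h2.ne' h3.ne', margW,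
        ← Fintype.sum_prod_type' (f := fun x y => P (x, y, w))]
      ring
  simp only [mutualInfoXYW, h1, Finset.sum_sub_distrib]
  congr 1
  · rw [Fintype.sum_prod_type]
    refine Finset.sum_congr rfl fun x _ => Finset.sum_congr rfl fun y _ => ?_
    rw [Finset.sum_neg_distrib, ← Finset.sum_mul, negMulLog, ← hm, margXY, neg_mul]
  · simp only [homEntropy_eq, Fintype.sum_prod_type]
    symm
    rw [Finset.sum_comm]
    exact Finset.sum_congr rfl fun x _ => Finset.sum_comm

theorem mutualInfoXYW_nonneg {W : Type*} [Fintype W] {P : X × Y × W → ℝ}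
    (hP : P ∈ stdSimplex ℝ (X × Y × W)) : 0 ≤ mutualInfoXYW P := by
  rw [mutualInfoXYW_eq (π := fun z => margXY P z.1 z.2) hP.1 fun _ _ => rfl, sub_nonneg]
  refine (sum_homEntropy_le fun w z => hP.1 _).trans (le_of_eq ?_)
  refine homEntropy_of_sum_eq_one ?_
  rw [← hP.2]
  simp only [Fintype.sum_prod_type]

theorem mem_infoSet_of_mem_wynerValues {π : X × Y → ℝ} (hπ : π ∈ stdSimplex ℝ (X × Y)) {I : ℝ}
    (hI : I ∈ wynerValues π) : (π, ∑ z, negMulLog (π z) - I, 0) ∈ infoSet X Y := by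
  obtain ⟨k, P, hP, hm, hM, rfl⟩ := hI
  have hnn : ∀ w, 0 ≤ margW P w := fun w =>
    Finset.sum_nonneg fun x _ => Finset.sum_nonneg fun y _ => hP.1 _
  have hsum : ∀ w, ∑ z : X × Y, P (z.1, z.2, w) = margW P w := fun w => by
    rw [margW, Fintype.sum_prod_type]
  have hmul : ∀ (w : Fin k) (z : X × Y), P (z.1, z.2, w) = margW P w *
      (if margW P w = 0 then π z else P (z.1, z.2, w) / margW P w) := by
    intro w z
    split_ifs with h
    · rw [h, zero_mul]
      rw [← hsum] at h
      exact (Finset.sum_eq_zero_iff_of_nonneg fun z _ => hP.1 _).1 h z (Finset.mem_univ z)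
    · field_simp
  -- The conditional law given `w`; at null `w` the default `π` is an arbitrary distribution
  -- carrying weight zero.
  set Q : Fin k → X × Y → ℝ := fun w z =>
    if margW P w = 0 then π z else P (z.1, z.2, w) / margW P w with hQdef
  have hQ : ∀ w, Q w ∈ stdSimplex ℝ (X × Y) := by
    intro w
    by_cases h : margW P w = 0
    · simpa [hQdef, h] using hπ
    · refine ⟨fun z => ?_, ?_⟩
      · simpa [hQdef, h] using div_nonneg (hP.1 _) (hnn w)
      · simp only [hQdef, h, if_false]
        rw [← Finset.sum_div, hsum, div_self h]
  have hQ0 : ∀ w, margW P w * homMutualInfo (Q w) = 0 := by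
    intro w
    by_cases h : margW P w = 0
    · simp [h]
    rw [homMutualInfo_eq_zero_of_mul (hQ w), mul_zero]
    intro x y
    have := hM x y w
    simp only [hQdef, h, if_false, ← Finset.sum_div]
    simp only [margXW, margYW] at this
    field_simp
    linarith
  refine mem_convexHull_of_exists_fintype (margW P) (fun w => infoPoint (Q w)) hnn ?_
    (fun w => ⟨Q w, hQ w, rfl⟩) ?_
  · rw [← hP.2]
    simp only [margW, Fintype.sum_prod_type]
    rw [Finset.sum_comm]
    exact Finset.sum_congr rfl fun x _ => Finset.sum_comm
  · refine Prod.ext ?_ (Prod.ext ?_ ?_)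
    · funext z
      simp only [infoPoint, Prod.fst_sum, Prod.smul_mk, Finset.sum_apply, Pi.smul_apply,
        smul_eq_mul]
      rw [← hm z.1 z.2, margXY]
      exact Finset.sum_congr rfl fun w _ => (hmul w z).symm
    · simp only [infoPoint, Prod.fst_sum, Prod.snd_sum, Prod.smul_mk, smul_eq_mul]
      rw [mutualInfoXYW_eq hP.1 hm, sub_sub_cancel]
      refine Finset.sum_congr rfl fun w _ => ?_
      rw [← homEntropy_smul]
      congr 1
      exact funext fun z => (hmul w z).symm
    · simp [infoPoint, Prod.snd_sum, hQ0]

/-- The index of the convex combination serves as `W`. Nonnegative mutual informations averaging to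
zero vanish wherever the weight is positive, so the conditional laws are products and the Markov
condition holds. -/
theorem mem_wynerValues_of_mem_infoSet {π : X × Y → ℝ} {h : ℝ}
    (hh : (π, h, 0) ∈ infoSet X Y) : ∑ z, negMulLog (π z) - h ∈ wynerValues π := by
  obtain ⟨ι, _, w, z, hw, hw1, hz, heq⟩ := mem_convexHull_iff_exists_fintype.1 hh
  choose Q hQ hQz using hz
  obtain rfl : z = fun i => infoPoint (Q i) := funext fun i => (hQz i).symm
  simp only [infoPoint, Prod.smul_mk, smul_eq_mul, Prod.ext_iff, Prod.fst_sum, Prod.snd_sum] at heq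
  obtain ⟨h1, h2, h3⟩ := heq
  set e := (Fintype.equivFin ι).symm
  have hQ0 : ∀ i, w i * homMutualInfo (Q i) = 0 := fun i =>
    (Finset.sum_eq_zero_iff_of_nonneg fun i _ => mul_nonneg (hw i)
      (homMutualInfo_nonneg (hQ i).1 (hQ i).2)).1 h3 i (Finset.mem_univ i)
  set P : X × Y × Fin (Fintype.card ι) → ℝ := fun t => w (e t.2.2) * Q (e t.2.2) (t.1, t.2.1)
  have hPW : ∀ j, margW P j = w (e j) := fun j => by
    simp only [margW, P]
    rw [← Fintype.sum_prod_type' (f := fun x y => w (e j) * Q (e j) (x, y)), ← Finset.mul_sum,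
      (hQ _).2, mul_one]
  have hm : ∀ x y, margXY P x y = π (x, y) := fun x y => by
    simp only [margXY, P]
    rw [e.sum_comp fun i => w i * Q i (x, y), ← h1]
    simp
  have hP : ∀ t, 0 ≤ P t := fun t => mul_nonneg (hw _) ((hQ _).1 _)
  refine ⟨Fintype.card ι, P, ⟨hP, ?_⟩, hm, ?_, ?_⟩
  · calc ∑ t, P t = ∑ j, margW P j := by
          simp only [margW, Fintype.sum_prod_type]
          symm
          rw [Finset.sum_comm]
          exact Finset.sum_congr rfl fun x _ => Finset.sum_comm
      _ = 1 := by
          simp only [hPW]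
          rw [e.sum_comp w, hw1]
  · intro x y j
    rw [hPW]
    simp only [margXW, margYW, P, ← Finset.mul_sum]
    rcases mul_eq_zero.1 (hQ0 (e j)) with h0 | h0
    · simp [h0]
    · rw [eq_mul_of_homMutualInfo_eq_zero (hQ _).1 (hQ _).2 h0 x y]
      ring
  · rw [mutualInfoXYW_eq hP hm, ← h2]
    congr 1
    rw [← e.sum_comp fun i => w i * homEntropy (Q i)]
    refine Finset.sum_congr rfl fun j _ => ?_
    rw [← homEntropy_smul]

/-- Take `W = (X, Y)`: point masses have neither entropy nor mutual information. Hence the minimum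
is over a nonempty set. -/
theorem mem_infoSet_self {π : X × Y → ℝ} (hπ : π ∈ stdSimplex ℝ (X × Y)) :
    (π, 0, 0) ∈ infoSet X Y := by
  classical
  have hs : ∀ z : X × Y, (Pi.single z 1 : X × Y → ℝ) ∈ stdSimplex ℝ (X × Y) := fun z =>
    single_mem_stdSimplex ℝ z
  refine mem_convexHull_of_exists_fintype π (fun z => infoPoint (Pi.single z 1)) hπ.1 hπ.2
    (fun z => ⟨_, hs z, rfl⟩) ?_
  have hH : ∀ z : X × Y, homEntropy (Pi.single z 1 : X × Y → ℝ) = 0 := fun z => by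
    rw [homEntropy_of_sum_eq_one (hs z).2]
    refine Finset.sum_eq_zero fun w _ => ?_
    by_cases h : w = z
    · simp [h]
    · simp [h]
  have hI : ∀ z : X × Y, homMutualInfo (Pi.single z 1 : X × Y → ℝ) = 0 := fun z => by
    refine homMutualInfo_eq_zero_of_mul (hs z) fun x y => ?_
    obtain ⟨a, b⟩ := z
    simp only [Pi.single_apply, Prod.mk.injEq]
    by_cases hx : x = a <;> by_cases hy : y = b <;> simp [hx, hy]
  refine Prod.ext ?_ (Prod.ext ?_ ?_)
  · funext z
    simp [infoPoint, Prod.fst_sum, Finset.sum_apply, Pi.single_apply]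
  · simp [infoPoint, Prod.fst_sum, Prod.snd_sum, hH]
  · simp [infoPoint, Prod.snd_sum, hI]

/-- The values form an affine image of a closed slice of the compact `infoSet`, so no separate bound
on the alphabet of `W` is needed. -/
theorem isLeast_wynerCI {π : X × Y → ℝ} (hπ : π ∈ stdSimplex ℝ (X × Y)) :
    IsLeast (wynerValues π) (wynerCI π) := by
  set S : Set ((X × Y → ℝ) × ℝ × ℝ) := infoSet X Y ∩ {v | v.1 = π ∧ v.2.2 = 0} with hS
  have hcl : IsClosed {v : (X × Y → ℝ) × ℝ × ℝ | v.1 = π ∧ v.2.2 = 0} :=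
    (isClosed_eq continuous_fst continuous_const).inter
      (isClosed_eq (continuous_snd.comp continuous_snd) continuous_const)
  have himage : wynerValues π =
      (fun v : (X × Y → ℝ) × ℝ × ℝ => ∑ z, negMulLog (π z) - v.2.1) '' S := by
    ext I
    constructor
    · intro hI
      exact ⟨_, ⟨mem_infoSet_of_mem_wynerValues hπ hI, rfl, rfl⟩, sub_sub_cancel _ _⟩
    · rintro ⟨⟨q, h, j⟩, ⟨hv, h1, h2⟩, rfl⟩
      simp only at h1 h2
      subst h1 h2
      exact mem_wynerValues_of_mem_infoSet hv
  have hcomp : IsCompact (wynerValues π) := by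
    rw [himage]
    exact (isCompact_infoSet.inter_right hcl).image (by fun_prop)
  have hne : (wynerValues π).Nonempty := ⟨_, mem_wynerValues_of_mem_infoSet (mem_infoSet_self hπ)⟩
  exact hcomp.isLeast_sInf hne

theorem wynerCI_nonneg {π : X × Y → ℝ} (hπ : π ∈ stdSimplex ℝ (X × Y)) : 0 ≤ wynerCI π := by
  obtain ⟨k, P, hP, -, -, hI⟩ := (isLeast_wynerCI hπ).1
  rw [← hI]
  exact mutualInfoXYW_nonneg hP

/-- The dual description of Wyner's common information. -/
theorem exists_multipliers_of_lt_wynerCI {π : X × Y → ℝ} (hπ : π ∈ stdSimplex ℝ (X × Y)) {R : ℝ}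
    (hR : R < wynerCI π) :
    ∃ (φ : X × Y → ℝ) (μ c : ℝ), 0 ≤ μ ∧
      (∀ Q ∈ stdSimplex ℝ (X × Y),
        c ≤ ∑ z, Q z * φ z - homEntropy Q + μ * homMutualInfo Q) ∧
      R < c - ∑ z, π z * φ z + ∑ z, negMulLog (π z) := by
  classical
  have hnot : (π, ∑ z, negMulLog (π z) - R, 0) ∉ infoSet X Y := by
    intro h
    have := (isLeast_wynerCI hπ).2 (mem_wynerValues_of_mem_infoSet h)
    rw [sub_sub_cancel] at this
    linarith
  obtain ⟨f, u, hf1, hf2⟩ := geometric_hahn_banach_point_closed (convex_convexHull ℝ _)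
    isCompact_infoSet.isClosed hnot
  set φ : X × Y → ℝ := fun z => f (Pi.single z 1, 0, 0) with hφ
  set α := f (0, 1, 0) with hα
  set β := f (0, 0, 1) with hβ
  have hf : ∀ q h j, f (q, h, j) = ∑ z, q z * φ z + α * h + β * j := by
    intro q h j
    have : ((q, h, j) : (X × Y → ℝ) × ℝ × ℝ) =
        ∑ z, q z • ((Pi.single z 1 : X × Y → ℝ), (0 : ℝ), (0 : ℝ)) +
          h • ((0 : X × Y → ℝ), (1 : ℝ), (0 : ℝ)) + j • ((0 : X × Y → ℝ), (0 : ℝ), (1 : ℝ)) := by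
      refine Prod.ext ?_ (Prod.ext ?_ ?_)
      · funext z
        simp [Prod.fst_sum, Finset.sum_apply, Pi.single_apply]
      · simp [Prod.snd_sum]
      · simp [Prod.snd_sum]
    rw [this]
    simp only [map_add, map_sum, map_smul, smul_eq_mul]
    ring
  have hC := hf2 _ (mem_infoSet_of_mem_wynerValues hπ (isLeast_wynerCI hπ).1)
  rw [hf] at hf1 hC
  -- The separated point has larger entropy than the optimal point of the hull, yet a smaller value
  -- of `f`.
  have hαneg : α < 0 := by
    by_contra! h
    have : α * (∑ z, negMulLog (π z) - wynerCI π) ≤ α * (∑ z, negMulLog (π z) - R) :=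
      mul_le_mul_of_nonneg_left (by linarith) h
    linarith
  obtain ⟨γ, hγ, hαγ⟩ : ∃ γ, 0 < γ ∧ α = -γ := ⟨-α, by linarith, by ring⟩
  rw [hαγ] at hf hf1
  -- Normalise the entropy coefficient to `-1`. Replacing `β / γ` by its positive part only helps,
  -- as mutual information is nonnegative and vanishes at the separated point.
  refine ⟨fun z => φ z / γ, max (β / γ) 0, u / γ, le_max_right _ _, fun Q hQ => ?_, ?_⟩
  · have h1 := hf2 _ (subset_convexHull ℝ _ ⟨Q, hQ, rfl⟩)
    rw [infoPoint, hf] at h1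
    have h2 : β / γ * homMutualInfo Q ≤ max (β / γ) 0 * homMutualInfo Q :=
      mul_le_mul_of_nonneg_right (le_max_left _ _) (homMutualInfo_nonneg hQ.1 hQ.2)
    refine le_trans ?_ (add_le_add_right h2 _)
    simp only [← mul_div_assoc, ← Finset.sum_div]
    rw [div_le_iff₀ hγ]
    have : (∑ z, Q z * φ z) / γ * γ = ∑ z, Q z * φ z := by field_simp
    have : β / γ * homMutualInfo Q * γ = β * homMutualInfo Q := by field_simp
    nlinarith
  · simp only [← mul_div_assoc, ← Finset.sum_div]
    have h3 : (∑ z, π z * φ z) / γ - (∑ z, negMulLog (π z) - R) < u / γ := by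
      rw [lt_div_iff₀ hγ, sub_mul, div_mul_cancel₀ _ hγ.ne']
      linarith
    linarith

end InfoSet

/-! ### Product distributions, overlap and exponential moments -/

section ProductDist

open Real (log exp)

theorem sum_pi_prod_prod {X Y : Type*} [Fintype X] [Fintype Y] (g : X × Y → ℝ) (n : ℕ) :
    ∑ z : (Fin n → X) × (Fin n → Y), ∏ i, g (z.1 i, z.2 i) = (∑ z, g z) ^ n := by
  rw [Fintype.sum_pow, ← (Equiv.arrowProdEquivProdArrow (Fin n) (fun _ => X) fun _ => Y).sum_comp]
  rfl

theorem productDist_mem_stdSimplex {X Y : Type*} [Fintype X] [Fintype Y] {π : X × Y → ℝ}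
    (hπ : π ∈ stdSimplex ℝ (X × Y)) (n : ℕ) :
    productDist π n ∈ stdSimplex ℝ ((Fin n → X) × (Fin n → Y)) :=
  ⟨fun z => Finset.prod_nonneg fun i _ => hπ.1 _, by
    simp only [productDist]
    rw [sum_pi_prod_prod, hπ.2, one_pow]⟩

theorem SynthesisCode.inducedDist_mem_stdSimplex {X Y : Type*} [Fintype X] [Fintype Y] {n : ℕ}
    (c : SynthesisCode X Y n) :
    c.inducedDist ∈ stdSimplex ℝ ((Fin n → X) × (Fin n → Y)) := by
  constructor
  · intro z
    exact mul_nonneg (by positivity) (Finset.sum_nonneg fun m _ =>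
      mul_nonneg ((c.encX_mem m).1 _) ((c.encY_mem m).1 _))
  · have : (c.numMessages : ℝ) ≠ 0 := by exact_mod_cast c.numMessages_pos.ne'
    simp only [SynthesisCode.inducedDist, ← Finset.mul_sum]
    rw [Finset.sum_comm]
    simp only [Fintype.sum_prod_type, ← Finset.mul_sum, (c.encY_mem _).2, mul_one,
      (c.encX_mem _).2, Finset.sum_const, Finset.card_univ, Fintype.card_fin, nsmul_eq_mul]
    field_simp

theorem tvDist_eq_one_sub_sum_min {α : Type*} [Fintype α] {P Q : α → ℝ}
    (hP : P ∈ stdSimplex ℝ α) (hQ : Q ∈ stdSimplex ℝ α) :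
    tvDist P Q = 1 - ∑ a, min (P a) (Q a) := by
  have h : ∀ a, |P a - Q a| = P a + Q a - 2 * min (P a) (Q a) := fun a => by
    rcases le_total (P a) (Q a) with h | h
    · rw [min_eq_left h, abs_of_nonpos (by linarith)]
      ring
    · rw [min_eq_right h, abs_of_nonneg (by linarith)]
      ring
  simp only [tvDist, h, Finset.sum_sub_distrib, Finset.sum_add_distrib, hP.2, hQ.2,
    ← Finset.mul_sum]
  ring

/-- The moment generating function at small arguments. -/
theorem exists_sum_mul_exp_le {α : Type*} [Fintype α] {p : α → ℝ} (hp : p ∈ stdSimplex ℝ α)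
    (ψ : α → ℝ) {η : ℝ} (hη : 0 < η) :
    ∃ t, 0 < t ∧ ∑ a, p a * exp (t * ψ a) ≤ exp (t * (∑ a, p a * ψ a + η)) := by
  set B := 1 + ∑ a, |ψ a| with hB
  have hB1 : 1 ≤ B := by
    have : 0 ≤ ∑ a, |ψ a| := Finset.sum_nonneg fun a _ => abs_nonneg _
    linarith
  have hψB : ∀ a, |ψ a| ≤ B := fun a => by
    have := Finset.single_le_sum (f := fun a => |ψ a|) (fun a _ => abs_nonneg _)
      (Finset.mem_univ a)
    linarith
  have hB0 : 0 < B := by linarith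
  set t := min (1 / B) (η / B ^ 2) with ht
  have ht0 : 0 < t := lt_min (by positivity) (by positivity)
  have htB : t * B ≤ 1 := by
    have := min_le_left (1 / B) (η / B ^ 2)
    rwa [← ht, le_div_iff₀ hB0] at this
  have htη : t * B ^ 2 ≤ η := by
    have := min_le_right (1 / B) (η / B ^ 2)
    rwa [← ht, le_div_iff₀ (by positivity)] at this
  refine ⟨t, ht0, ?_⟩
  have key : ∀ a, exp (t * ψ a) ≤ 1 + t * ψ a + t * η := by
    intro a
    have h1 : |t * ψ a| ≤ 1 := by
      rw [abs_mul, abs_of_pos ht0]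
      exact (mul_le_mul_of_nonneg_left (hψB a) ht0.le).trans htB
    have h2 := (abs_le.1 (Real.abs_exp_sub_one_sub_id_le h1)).2
    have h3 : (t * ψ a) ^ 2 ≤ t * η := by
      have h4 : ψ a ^ 2 ≤ B ^ 2 := sq_le_sq' (by linarith [(abs_le.1 (hψB a)).1])
        (abs_le.1 (hψB a)).2
      calc (t * ψ a) ^ 2 = t * (t * ψ a ^ 2) := by ring
        _ ≤ t * (t * B ^ 2) := by gcongr
        _ ≤ t * η := by gcongr
    linarith
  calc ∑ a, p a * exp (t * ψ a) ≤ ∑ a, p a * (1 + t * ψ a + t * η) :=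
        Finset.sum_le_sum fun a _ => mul_le_mul_of_nonneg_left (key a) (hp.1 a)
    _ = t * (∑ a, p a * ψ a + η) + 1 := by
        have : ∀ a, p a * (1 + t * ψ a + t * η) = p a * (1 + t * η) + t * (p a * ψ a) :=
          fun a => by ring
        simp only [this, Finset.sum_add_distrib, ← Finset.sum_mul, ← Finset.mul_sum, hp.2]
        ring
    _ ≤ exp (t * (∑ a, p a * ψ a + η)) := Real.add_one_le_exp _

end ProductDist

/-! ### The exponential strong converse -/

section Converse

open Real (log exp negMulLog)

variable {X Y : Type*} [Fintype X] [Fintype Y]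

/-- Both sides are homogeneous of degree one. Unnormalised measures are needed for the message
pieces and for the slices in the induction. -/
theorem mul_sum_le_of_forall_stdSimplex {φ : X × Y → ℝ} {μ c : ℝ}
    (h : ∀ Q ∈ stdSimplex ℝ (X × Y), c ≤ ∑ z, Q z * φ z - homEntropy Q + μ * homMutualInfo Q)
    {q : X × Y → ℝ} (hq : ∀ z, 0 ≤ q z) :
    c * ∑ z, q z ≤ ∑ z, q z * φ z - homEntropy q + μ * homMutualInfo q := by
  rcases (Finset.sum_nonneg fun z _ => hq z).eq_or_lt with h0 | ht
  · have h1 : q = fun z => 0 * 0 := funext fun z => by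
      rw [mul_zero]
      exact (Finset.sum_eq_zero_iff_of_nonneg fun i _ => hq i).1 h0.symm z (Finset.mem_univ z)
    rw [h1, homEntropy_smul, homMutualInfo_smul]
    simp
  · set t := ∑ z, q z
    have h1 : q = fun z => t * (q z / t) := funext fun z => by field_simp
    have h2 := h (fun z => q z / t) ⟨fun z => div_nonneg (hq z) ht.le, by
      rw [← Finset.sum_div, div_self ht.ne']⟩
    rw [h1, homEntropy_smul, homMutualInfo_smul]
    simp only [mul_assoc, ← Finset.mul_sum]
    have := mul_le_mul_of_nonneg_left h2 ht.le
    linarith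

/-- Single-letterization of the Lagrangian `E[φ] - H(XY) + μ I(X;Y)`. -/
theorem nsmul_mul_sum_le {φ : X × Y → ℝ} {μ c : ℝ} (hμ : 0 ≤ μ)
    (h : ∀ q : X × Y → ℝ, (∀ z, 0 ≤ q z) →
      c * ∑ z, q z ≤ ∑ z, q z * φ z - homEntropy q + μ * homMutualInfo q) :
    ∀ (n : ℕ) {q : (Fin n → X) × (Fin n → Y) → ℝ}, (∀ z, 0 ≤ q z) →
      n * c * ∑ z, q z ≤ ∑ z, q z * ∑ i, φ (z.1 i, z.2 i) - homEntropy q + μ * homMutualInfo q := by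
  intro n
  induction n with
  | zero =>
    intro q hq
    simp [homMutualInfo, homEntropy, Fintype.sum_prod_type]
  | succ n ih =>
    intro q hq
    set eX : X × (Fin n → X) ≃ (Fin (n + 1) → X) := Fin.consEquiv fun _ => X with heX
    set eY : Y × (Fin n → Y) ≃ (Fin (n + 1) → Y) := Fin.consEquiv fun _ => Y with heY
    set p : (X × (Fin n → X)) × (Y × (Fin n → Y)) → ℝ := q ∘ eX.prodCongr eY with hp
    have hp0 : ∀ z, 0 ≤ p z := fun z => hq _
    have hsum : ∀ F : (Fin (n + 1) → X) × (Fin (n + 1) → Y) → ℝ,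
        ∑ v, F v = ∑ z : X × Y, ∑ w : (Fin n → X) × (Fin n → Y),
          F (eX (z.1, w.1), eY (z.2, w.2)) := by
      intro F
      rw [← (eX.prodCongr eY).sum_comp, ← (Equiv.prodProdProdComm X Y (Fin n → X) _).sum_comp,
        Fintype.sum_prod_type]
      rfl
    have hH : homEntropy q =
        homEntropy (fun z : X × Y => ∑ w : (Fin n → X) × (Fin n → Y),
          p ((z.1, w.1), (z.2, w.2))) +
        ∑ z : X × Y, homEntropy
          (fun w : (Fin n → X) × (Fin n → Y) => p ((z.1, w.1), (z.2, w.2))) := by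
      rw [← homEntropy_comp_equiv (eX.prodCongr eY) q,
        ← homEntropy_comp_equiv (Equiv.prodProdProdComm X Y (Fin n → X) _), homEntropy_prod]
      rfl
    -- With the first letter pair split off, this inequality is usable because `μ ≥ 0`; the entropy
    -- term in `hH` is exact, so its negative sign does no harm.
    have hI := homMutualInfo_prod_le hp0
    rw [hp, homMutualInfo_comp_equiv, ← hp] at hI
    have h1 := h (fun z : X × Y => ∑ w : (Fin n → X) × (Fin n → Y), p ((z.1, w.1), (z.2, w.2)))
      fun z => Finset.sum_nonneg fun w _ => hp0 _
    have h2 := Finset.sum_le_sum fun (z : X × Y) (_ : z ∈ Finset.univ) =>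
      ih (q := fun w => p ((z.1, w.1), (z.2, w.2))) fun w => hp0 _
    rw [hsum q, hsum fun v => q v * ∑ i, φ (v.1 i, v.2 i), hH]
    have hφ : ∀ (z : X × Y) (w : (Fin n → X) × (Fin n → Y)),
        q (eX (z.1, w.1), eY (z.2, w.2)) *
          ∑ i, φ (eX (z.1, w.1) i, eY (z.2, w.2) i) =
        p ((z.1, w.1), (z.2, w.2)) * φ z +
          p ((z.1, w.1), (z.2, w.2)) * ∑ i, φ (w.1 i, w.2 i) := by
      intro z w
      rw [Fin.sum_univ_succ, mul_add]
      rfl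
    simp only [hφ, Finset.sum_add_distrib, ← Finset.sum_mul]
    simp only [Finset.sum_add_distrib, Finset.sum_sub_distrib, ← Finset.mul_sum] at h2
    have h3 := mul_le_mul_of_nonneg_left hI hμ
    have h4 : ∀ (z : X × Y) (w : (Fin n → X) × (Fin n → Y)),
        q (eX (z.1, w.1), eY (z.2, w.2)) = p ((z.1, w.1), (z.2, w.2)) := fun _ _ => rfl
    simp only [h4]
    push_cast
    rw [mul_add] at h3
    linarith

/-- The non-asymptotic converse: if a measure `∑ₘ qₘ ≤ π^n` of mass `θ` is dominated by a uniform
mixture of `M` product distributions, then `M` cannot be small. -/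
theorem nsmul_le_log_card_add {π φ : X × Y → ℝ} {μ c t A : ℝ} {n M : ℕ}
    (hπ : π ∈ stdSimplex ℝ (X × Y)) (hμ : 0 ≤ μ)
    (h : ∀ Q ∈ stdSimplex ℝ (X × Y), c ≤ ∑ z, Q z * φ z - homEntropy Q + μ * homMutualInfo Q)
    (ht : 0 < t) (hA : ∑ z, π z * exp (t * (φ z + log (π z))) ≤ exp (t * A)) (hM : 0 < M)
    {q : Fin M → (Fin n → X) × (Fin n → Y) → ℝ} {u : Fin M → (Fin n → X) → ℝ}
    {v : Fin M → (Fin n → Y) → ℝ} (hq : ∀ m z, 0 ≤ q m z) (hu : ∀ m, u m ∈ stdSimplex ℝ _)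
    (hv : ∀ m, v m ∈ stdSimplex ℝ _) (hquv : ∀ m x y, q m (x, y) ≤ 1 / M * (u m x * v m y))
    (hqπ : ∀ z, ∑ m, q m z ≤ productDist π n z) {θ : ℝ} (hθ : ∑ z, ∑ m, q m z = θ)
    (hθ0 : 0 < θ) :
    n * c ≤ n * A + log M + (1 / t + 1 + μ) * -log θ := by
  set ν : (Fin n → X) × (Fin n → Y) → ℝ := fun z => ∑ m, q m z with hν
  have hν0 : ∀ z, 0 ≤ ν z := fun z => Finset.sum_nonneg fun m _ => hq m z
  have hM' : (0 : ℝ) < M := by exact_mod_cast hM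
  have hθ' : ∑ m, ∑ z, q m z = θ := by rw [Finset.sum_comm, hθ]
  have hqν : ∀ m z, q m z ≤ ν z := fun m z =>
    Finset.single_le_sum (f := fun m => q m z) (fun m _ => hq m z) (Finset.mem_univ m)
  have ht0 : ∀ m, 0 ≤ ∑ z, q m z := fun m => Finset.sum_nonneg fun z _ => hq m z
  have hlogprod : ∀ z, 0 < productDist π n z →
      log (productDist π n z) = ∑ i, log (π (z.1 i, z.2 i)) ∧ ∀ i, π (z.1 i, z.2 i) ≠ 0 := by
    intro z hz
    have hne : ∀ i, π (z.1 i, z.2 i) ≠ 0 := fun i hi =>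
      hz.ne' (Finset.prod_eq_zero (Finset.mem_univ i) hi)
    exact ⟨Real.log_prod fun i _ => hne i, hne⟩
  have hmain : n * c * θ ≤ ∑ z, ν z * ∑ i, φ (z.1 i, z.2 i) - ∑ m, homEntropy (q m) +
      μ * ∑ m, homMutualInfo (q m) := by
    have h1 := Finset.sum_le_sum fun (m : Fin M) (_ : m ∈ Finset.univ) =>
      nsmul_mul_sum_le hμ (fun q hq => mul_sum_le_of_forall_stdSimplex h hq) n (hq m)
    simp only [Finset.sum_add_distrib, Finset.sum_sub_distrib, ← Finset.mul_sum, hθ'] at h1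
    refine h1.trans (le_of_eq ?_)
    congr 2
    rw [Finset.sum_comm]
    simp only [hν, Finset.sum_mul]
  -- The factors `1 / M` sum to one over the messages, so the log-sum inequality removes `M` from
  -- this term.
  have hMI : ∑ m, homMutualInfo (q m) ≤ θ * -log θ := by
    calc ∑ m, homMutualInfo (q m)
        ≤ ∑ m, (∑ z, q m z) * (log (1 / M) - log (∑ z, q m z)) :=
          Finset.sum_le_sum fun m _ => homMutualInfo_le (by positivity) (hq m) (hu m).1 (hv m).1
            (hu m).2.le (hv m).2.le (hquv m)
      _ ≤ (∑ m, ∑ z, q m z) * (log 1 - log (∑ m, ∑ z, q m z)) := by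
          refine sum_mul_log_sub_log_le (t := fun _ => 1 / (M : ℝ)) ht0
            (fun m => by positivity) (fun m hm => ?_) ?_
          · exact absurd hm (by positivity)
          · simp [hM'.ne']
      _ = θ * -log θ := by rw [hθ', Real.log_one, zero_sub]
  -- Inside the pieces use `q m ≤ π^n`; the entropy of the message masses is what produces `log M`.
  have hH : -∑ m, homEntropy (q m) ≤
      ∑ z, ν z * ∑ i, log (π (z.1 i, z.2 i)) + θ * (log M - log θ) := by
    have h1 : -∑ m, homEntropy (q m) = ∑ m, ∑ z, q m z * log (q m z) +
        ∑ m, (∑ z, q m z) * (log 1 - log (∑ z, q m z)) := by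
      rw [← Finset.sum_neg_distrib, ← Finset.sum_add_distrib]
      refine Finset.sum_congr rfl fun m _ => ?_
      simp only [homEntropy, negMulLog, neg_mul, Finset.sum_neg_distrib, Real.log_one]
      ring
    rw [h1]
    refine add_le_add ?_ ?_
    · rw [Finset.sum_comm]
      refine Finset.sum_le_sum fun z _ => ?_
      simp only [hν, Finset.sum_mul]
      refine Finset.sum_le_sum fun m _ => ?_
      rcases (hq m z).eq_or_lt with h0 | h0
      · simp [← h0]
      · have h2 : q m z ≤ productDist π n z := (hqν m z).trans (hqπ z)
        rw [← (hlogprod z (h0.trans_le h2)).1]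
        exact mul_le_mul_of_nonneg_left (Real.log_le_log h0 h2) h0.le
    · rw [← hθ']
      refine sum_mul_log_sub_log_le (t := fun _ => 1) ht0 (fun m => zero_le_one)
        (fun m hm => absurd hm one_ne_zero) ?_
      simp
  -- Change of measure: log-sum against `π^n` tilted by `exp (t * S)`, whose mass is at most `exp (t
  -- * A) ^ n`; then `ν ≤ π^n` removes the remaining logarithms.
  have hS : t * ∑ z, ν z * ∑ i, (φ (z.1 i, z.2 i) + log (π (z.1 i, z.2 i))) ≤
      θ * (n * (t * A) - log θ) := by
    set S : (Fin n → X) × (Fin n → Y) → ℝ :=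
      fun z => ∑ i, (φ (z.1 i, z.2 i) + log (π (z.1 i, z.2 i))) with hSdef
    have h1 := sum_mul_log_sub_log_le (x := ν) (t := fun z => productDist π n z * exp (t * S z))
      (T := exp (t * A) ^ n) hν0
      (fun z => mul_nonneg ((productDist_mem_stdSimplex hπ n).1 z) (Real.exp_pos _).le)
      (fun z hz => by
        rcases mul_eq_zero.1 hz with hz | hz
        · exact le_antisymm ((hqπ z).trans hz.le) (hν0 z)
        · exact absurd hz (Real.exp_pos _).ne')
      (by
        refine le_trans (le_of_eq ?_) (pow_le_pow_left₀ (Finset.sum_nonneg fun z _ =>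
          mul_nonneg (hπ.1 z) (Real.exp_pos _).le) hA n)
        rw [← sum_pi_prod_prod]
        refine Finset.sum_congr rfl fun z _ => ?_
        rw [Finset.prod_mul_distrib, ← Real.exp_sum, hSdef, Finset.mul_sum]
        rfl)
    rw [hν, hθ, ← hν, Real.log_pow, Real.log_exp] at h1
    refine le_trans ?_ h1
    rw [Finset.mul_sum]
    refine Finset.sum_le_sum fun z _ => ?_
    rcases (hν0 z).eq_or_lt with h0 | h0
    · simp [← h0]
    · have h2 : 0 < productDist π n z := h0.trans_le (hqπ z)
      rw [Real.log_mul h2.ne' (Real.exp_pos _).ne', Real.log_exp]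
      have := mul_le_mul_of_nonneg_left (Real.log_le_log h0 (hqπ z)) h0.le
      linarith
  have hS' : ∑ z, ν z * ∑ i, φ (z.1 i, z.2 i) + ∑ z, ν z * ∑ i, log (π (z.1 i, z.2 i)) ≤
      θ * (n * A + 1 / t * -log θ) := by
    rw [← Finset.sum_add_distrib]
    simp only [← mul_add, ← Finset.sum_add_distrib]
    refine le_of_mul_le_mul_left (hS.trans (le_of_eq ?_)) ht
    field_simp
    ring
  refine le_of_mul_le_mul_left ?_ hθ0
  have := mul_le_mul_of_nonneg_left hMI hμ
  linarith

/-- The exponential strong converse. -/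
theorem exists_one_sub_exp_le_tvError {π : X × Y → ℝ} (hπ : π ∈ stdSimplex ℝ (X × Y)) {R : ℝ}
    (hR : R < wynerCI π) :
    ∃ δ : ℝ, 0 < δ ∧ ∀ (n : ℕ) (c : SynthesisCode X Y n), 0 < n →
      log c.numMessages / n ≤ R → 1 - exp (-(n * δ)) ≤ c.tvError π := by
  obtain ⟨φ, μ, c₀, hμ, hφ, hgap⟩ := exists_multipliers_of_lt_wynerCI hπ hR
  set g := c₀ - ∑ z, π z * φ z + ∑ z, negMulLog (π z) - R with hg
  have hg0 : 0 < g := by linarith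
  obtain ⟨t, ht, hA⟩ := exists_sum_mul_exp_le hπ (fun z => φ z + log (π z)) (η := g / 4)
    (by linarith)
  have hE : ∑ z, π z * (φ z + log (π z)) = ∑ z, π z * φ z - ∑ z, negMulLog (π z) := by
    simp only [mul_add, Finset.sum_add_distrib, negMulLog, neg_mul, Finset.sum_neg_distrib]
    ring
  rw [hE] at hA
  have hK : 0 < 1 / t + 1 + μ := by positivity
  -- Of the gap `g`, one quarter pays for the moment bound and one for the `log θ` terms; the
  -- remaining half gives the contradiction.
  refine ⟨g / 4 / (1 / t + 1 + μ), by positivity, fun n c hn hc => ?_⟩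
  set δ := g / 4 / (1 / t + 1 + μ) with hδ
  have hn' : (0 : ℝ) < n := by exact_mod_cast hn
  have hM' : (0 : ℝ) < c.numMessages := by exact_mod_cast c.numMessages_pos
  have hP := c.inducedDist_mem_stdSimplex
  have hπn := productDist_mem_stdSimplex hπ n
  rw [SynthesisCode.tvError, tvDist_eq_one_sub_sum_min hP hπn]
  set θ := ∑ z, min (c.inducedDist z) (productDist π n z) with hθ
  refine sub_le_sub_left ?_ 1
  by_contra! hlt
  have hθ0 : 0 < θ := (Real.exp_pos _).trans hlt
  -- Thinning every message component by the common factor `r` turns the induced law into the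
  -- overlap and keeps domination by product laws.
  set r : (Fin n → X) × (Fin n → Y) → ℝ :=
    fun z => min (c.inducedDist z) (productDist π n z) / c.inducedDist z with hr
  have hr0 : ∀ z, 0 ≤ r z := fun z => div_nonneg (le_min (hP.1 z) (hπn.1 z)) (hP.1 z)
  have hr1 : ∀ z, r z ≤ 1 := fun z => div_le_one_of_le₀ (min_le_left _ _) (hP.1 z)
  have huv : ∀ m (z : (Fin n → X) × (Fin n → Y)), 0 ≤ 1 / (c.numMessages : ℝ) * (c.encX m z.1 * c.encY m z.2) := fun m z =>
    mul_nonneg (by positivity) (mul_nonneg ((c.encX_mem m).1 _) ((c.encY_mem m).1 _))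
  have hsum : ∀ (z : (Fin n → X) × (Fin n → Y)),
      ∑ m, 1 / (c.numMessages : ℝ) * (c.encX m z.1 * c.encY m z.2) * r z =
      min (c.inducedDist z) (productDist π n z) := by
    intro z
    rw [← Finset.sum_mul, ← Finset.mul_sum]
    change c.inducedDist z * r z = _
    rcases (hP.1 z).eq_or_lt with h0 | h0
    · rw [← h0, zero_mul, min_eq_left (hπn.1 z)]
    · exact mul_div_cancel₀ _ h0.ne'
  have hmain := nsmul_le_log_card_add hπ hμ hφ ht hA c.numMessages_pos
    (q := fun m (z : (Fin n → X) × (Fin n → Y)) =>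
      1 / (c.numMessages : ℝ) * (c.encX m z.1 * c.encY m z.2) * r z)
    (fun m z => mul_nonneg (huv m z) (hr0 z)) c.encX_mem c.encY_mem
    (fun m x y => mul_le_of_le_one_right (huv m (x, y)) (hr1 _))
    (fun z => (hsum z).trans_le (min_le_right _ _))
    (Finset.sum_congr rfl fun z _ => hsum z) hθ0
  have hlogθ : -log θ ≤ n * δ := by
    rw [neg_le, ← Real.log_exp (-(n * δ))]
    exact Real.log_le_log (Real.exp_pos _) hlt.le
  have h1 := mul_le_mul_of_nonneg_left hlogθ hK.le
  have h2 : (1 / t + 1 + μ) * (n * δ) = n * (g / 4) := by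
    rw [hδ]
    field_simp
  rw [div_le_iff₀ hn'] at hc
  have h3 : (n : ℝ) * (g / 2) > 0 := by positivity
  have h4 : (n : ℝ) * c₀ = n * (R + g + ∑ z, π z * φ z - ∑ z, negMulLog (π z)) := by
    rw [hg]
    ring
  rw [h4] at hmain
  linarith

end Converse

/-! ### Soft covering by a random codebook -/

section SoftCovering

variable {A Z : Type*} [Fintype A] [Fintype Z]

theorem sum_fin_succ_fun (M : ℕ) (F : (Fin (M + 1) → A) → ℝ) :
    ∑ w, F w = ∑ a, ∑ w : Fin M → A, F (Fin.cons a w) := by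
  rw [← (Fin.consEquiv fun _ : Fin (M + 1) => A).sum_comp, Fintype.sum_prod_type]
  rfl

theorem sum_prod_eq_one {p : A → ℝ} (hp : ∑ a, p a = 1) (M : ℕ) :
    ∑ w : Fin M → A, ∏ m, p (w m) = 1 := by
  rw [← Fintype.sum_pow, hp, one_pow]

/-- The mean of a sum of i.i.d. random variables. -/
theorem sum_prod_mul_sum {p : A → ℝ} (hp : ∑ a, p a = 1) (g : A → ℝ) (M : ℕ) :
    ∑ w : Fin M → A, (∏ m, p (w m)) * ∑ m, g (w m) = M * ∑ a, p a * g a := by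
  induction M with
  | zero => simp
  | succ M ih =>
    have h : ∀ a (w : Fin M → A), p a * (∏ m, p (w m)) * (g a + ∑ m, g (w m)) =
        p a * g a * (∏ m, p (w m)) + p a * ((∏ m, p (w m)) * ∑ m, g (w m)) := fun a w => by ring
    rw [sum_fin_succ_fun]
    simp only [Fin.prod_univ_succ, Fin.sum_univ_succ, Fin.cons_zero, Fin.cons_succ, h,
      Finset.sum_add_distrib, ← Finset.mul_sum, ih, sum_prod_eq_one hp, ← Finset.sum_mul, hp]
    push_cast
    ring

/-- The variance of a sum of centred i.i.d. random variables. -/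
theorem sum_prod_mul_sum_sq {p : A → ℝ} (hp : ∑ a, p a = 1) {g : A → ℝ}
    (hg : ∑ a, p a * g a = 0) (M : ℕ) :
    ∑ w : Fin M → A, (∏ m, p (w m)) * (∑ m, g (w m)) ^ 2 = M * ∑ a, p a * g a ^ 2 := by
  induction M with
  | zero => simp
  | succ M ih =>
    have h : ∀ a (w : Fin M → A), p a * (∏ m, p (w m)) * (g a + ∑ m, g (w m)) ^ 2 =
        p a * g a ^ 2 * (∏ m, p (w m)) + 2 * (p a * g a) * ((∏ m, p (w m)) * ∑ m, g (w m)) +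
          p a * ((∏ m, p (w m)) * (∑ m, g (w m)) ^ 2) := fun a w => by ring
    rw [sum_fin_succ_fun]
    simp only [Fin.prod_univ_succ, Fin.sum_univ_succ, Fin.cons_zero, Fin.cons_succ, h,
      Finset.sum_add_distrib, ← Finset.mul_sum, ih, sum_prod_eq_one hp, ← Finset.sum_mul, hp,
      sum_prod_mul_sum hp, hg]
    push_cast
    ring

/-- The mean deviation of an empirical mean of bounded i.i.d. random variables. -/
theorem sum_prod_mul_abs_sub_le {p : A → ℝ} (hp : p ∈ stdSimplex ℝ A) {f : A → ℝ} {M : ℕ}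
    (hM : 0 < M) {B v κ : ℝ} (hf : ∀ a, 0 ≤ f a) (hB : 0 ≤ B) (hfB : ∀ a, f a ≤ B * v)
    (hv : ∑ a, p a * f a ≤ v) (hκ : 0 < κ) :
    ∑ w : Fin M → A, (∏ m, p (w m)) * |1 / (M : ℝ) * ∑ m, f (w m) - ∑ a, p a * f a| ≤
      v * ((B / (M * κ) + κ) / 2) := by
  have hv0 : 0 ≤ v := (Finset.sum_nonneg fun a _ => mul_nonneg (hp.1 a) (hf a)).trans hv
  have hM' : (0 : ℝ) < M := by exact_mod_cast hM
  rcases hv0.eq_or_lt with h0 | hvpos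
  · have hf0 : ∀ a, f a = 0 := fun a => le_antisymm ((hfB a).trans (by rw [← h0, mul_zero])) (hf a)
    simp [hf0, ← h0]
  set e := ∑ a, p a * f a with he
  set g : A → ℝ := fun a => f a - e with hg
  have hg0 : ∑ a, p a * g a = 0 := by
    simp only [hg, mul_sub, Finset.sum_sub_distrib, ← Finset.sum_mul, hp.2, ← he]
    ring
  -- The variance is at most `E f² ≤ B v E f`, and `E f ≤ v`.
  have hg2 : ∑ a, p a * g a ^ 2 ≤ B * v ^ 2 := by
    have h1 : ∀ a, p a * g a ^ 2 = p a * f a ^ 2 - 2 * e * (p a * f a) + p a * e ^ 2 := fun a => by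
      simp only [hg]
      ring
    have h2 : ∑ a, p a * f a ^ 2 ≤ B * v * e := by
      rw [he, Finset.mul_sum]
      refine Finset.sum_le_sum fun a _ => ?_
      have := mul_le_mul_of_nonneg_left (hfB a) (mul_nonneg (hp.1 a) (hf a))
      linarith
    simp only [h1, Finset.sum_add_distrib, Finset.sum_sub_distrib, ← Finset.mul_sum,
      ← Finset.sum_mul, hp.2, ← he]
    have h3 : B * v * e ≤ B * v * v := mul_le_mul_of_nonneg_left hv (mul_nonneg hB hv0)
    nlinarith [sq_nonneg e]
  -- AM-GM in the form `2|y| ≤ y² / s + s` with `s = v * κ`; this scale makes the final bound linear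
  -- in `v`, hence summable over outputs.
  have habs : ∀ w : Fin M → A, |1 / (M : ℝ) * ∑ m, f (w m) - e| ≤
      ((∑ m, g (w m)) ^ 2 * (1 / (M ^ 2 * (v * κ))) + v * κ) / 2 := by
    intro w
    have h1 : 1 / (M : ℝ) * ∑ m, f (w m) - e = (∑ m, g (w m)) / M := by
      simp only [hg, Finset.sum_sub_distrib, Finset.sum_const, Finset.card_univ, Fintype.card_fin,
        nsmul_eq_mul]
      field_simp
    rw [h1]
    set y := (∑ m, g (w m)) / M
    have h2 : (∑ m, g (w m)) ^ 2 * (1 / (M ^ 2 * (v * κ))) = |y| ^ 2 / (v * κ) := by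
      rw [sq_abs]
      simp only [y]
      field_simp
    have hs : 0 < v * κ := by positivity
    rw [h2]
    have h3 : 0 ≤ (|y| - v * κ) ^ 2 / (v * κ) := by positivity
    have h4 : (|y| - v * κ) ^ 2 / (v * κ) = |y| ^ 2 / (v * κ) - 2 * |y| + v * κ := by
      field_simp
      ring
    linarith
  have hp0 : ∀ w : Fin M → A, 0 ≤ ∏ m, p (w m) := fun w => Finset.prod_nonneg fun m _ => hp.1 _
  calc ∑ w : Fin M → A, (∏ m, p (w m)) * |1 / (M : ℝ) * ∑ m, f (w m) - e|
      ≤ ∑ w : Fin M → A, (∏ m, p (w m)) *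
          (((∑ m, g (w m)) ^ 2 * (1 / (M ^ 2 * (v * κ))) + v * κ) / 2) :=
        Finset.sum_le_sum fun w _ => mul_le_mul_of_nonneg_left (habs w) (hp0 w)
    _ = ((M * ∑ a, p a * g a ^ 2) * (1 / (M ^ 2 * (v * κ))) + v * κ) / 2 := by
        rw [← sum_prod_mul_sum_sq hp.2 hg0, Finset.sum_mul, add_div, Finset.sum_div,
          ← one_mul (v * κ / 2), ← sum_prod_eq_one hp.2 M, Finset.sum_mul,
          ← Finset.sum_add_distrib]
        refine Finset.sum_congr rfl fun w _ => ?_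
        ring
    _ ≤ ((M * (B * v ^ 2)) * (1 / (M ^ 2 * (v * κ))) + v * κ) / 2 := by gcongr
    _ = v * ((B / (M * κ) + κ) / 2) := by
        field_simp

/-- The one-shot soft covering lemma. -/
theorem exists_codebook_tvDist_le {p : A → ℝ} (hp : p ∈ stdSimplex ℝ A) {V : A → Z → ℝ}
    (hV : ∀ a, V a ∈ stdSimplex ℝ Z) {M : ℕ} (hM : 0 < M) {B κ : ℝ} (hB : 0 ≤ B) (hκ : 0 < κ) :
    ∃ w : Fin M → A,
      tvDist (fun z => 1 / (M : ℝ) * ∑ m, V (w m) z) (fun z => ∑ a, p a * V a z) ≤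
        (B / (M * κ) + κ) / 4 +
        ∑ z, ∑ a, p a * if V a z ≤ B * ∑ a', p a' * V a' z then 0 else V a z := by
  set Q : Z → ℝ := fun z => ∑ a, p a * V a z with hQ
  -- The bounded part `f` gets the second-moment estimate; for the excess `r` the mean alone
  -- suffices.
  set f : Z → A → ℝ := fun z a => if V a z ≤ B * Q z then V a z else 0 with hf
  set r : Z → A → ℝ := fun z a => if V a z ≤ B * Q z then 0 else V a z with hr
  have hM' : (0 : ℝ) < M := by exact_mod_cast hM
  have hfr : ∀ z a, V a z = f z a + r z a := fun z a => by
    simp only [hf, hr]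
    split_ifs <;> simp
  have hr0 : ∀ z a, 0 ≤ r z a := fun z a => by
    simp only [hr]
    split_ifs
    exacts [le_rfl, (hV a).1 z]
  have hf0 : ∀ z a, 0 ≤ f z a := fun z a => by
    simp only [hf]
    split_ifs
    exacts [(hV a).1 z, le_rfl]
  have hQ0 : ∀ z, 0 ≤ Q z := fun z => Finset.sum_nonneg fun a _ => mul_nonneg (hp.1 a) ((hV a).1 z)
  have hQ1 : ∑ z, Q z = 1 := by
    simp only [hQ]
    rw [Finset.sum_comm]
    simp only [← Finset.mul_sum, (hV _).2, mul_one, hp.2]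
  have hfB : ∀ z a, f z a ≤ B * Q z := fun z a => by
    simp only [hf]
    split_ifs with h
    exacts [h, mul_nonneg hB (hQ0 z)]
  have hp0 : ∀ w : Fin M → A, 0 ≤ ∏ m, p (w m) := fun w => Finset.prod_nonneg fun m _ => hp.1 _
  set T := (B / (M * κ) + κ) / 2
  set E := ∑ z, ∑ a, p a * r z a with hE
  have hpoint : ∀ (w : Fin M → A) z, |1 / (M : ℝ) * ∑ m, V (w m) z - Q z| ≤
      |1 / (M : ℝ) * ∑ m, f z (w m) - ∑ a, p a * f z a| +
        (1 / (M : ℝ) * ∑ m, r z (w m) + ∑ a, p a * r z a) := by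
    intro w z
    have h1 : 1 / (M : ℝ) * ∑ m, V (w m) z - Q z =
        (1 / (M : ℝ) * ∑ m, f z (w m) - ∑ a, p a * f z a) +
          (1 / (M : ℝ) * ∑ m, r z (w m) - ∑ a, p a * r z a) := by
      simp only [hQ, hfr, mul_add, Finset.sum_add_distrib]
      ring
    have h2 : 0 ≤ 1 / (M : ℝ) * ∑ m, r z (w m) :=
      mul_nonneg (by positivity) (Finset.sum_nonneg fun m _ => hr0 z _)
    have h3 : 0 ≤ ∑ a, p a * r z a := Finset.sum_nonneg fun a _ => mul_nonneg (hp.1 a) (hr0 z a)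
    rw [h1]
    refine (abs_add_le _ _).trans (add_le_add_right (abs_le.2 ⟨by linarith, by linarith⟩) _)
  have hmean : ∑ w : Fin M → A, (∏ m, p (w m)) *
      tvDist (fun z => 1 / (M : ℝ) * ∑ m, V (w m) z) Q ≤ T / 2 + E := by
    calc ∑ w : Fin M → A, (∏ m, p (w m)) *
          tvDist (fun z => 1 / (M : ℝ) * ∑ m, V (w m) z) Q
        ≤ ∑ w : Fin M → A, (∏ m, p (w m)) * ((1 / 2) * ∑ z,
            (|1 / (M : ℝ) * ∑ m, f z (w m) - ∑ a, p a * f z a| +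
              (1 / (M : ℝ) * ∑ m, r z (w m) + ∑ a, p a * r z a))) := by
          refine Finset.sum_le_sum fun w _ => mul_le_mul_of_nonneg_left ?_ (hp0 w)
          exact mul_le_mul_of_nonneg_left (Finset.sum_le_sum fun z _ => hpoint w z) (by norm_num)
      _ = (1 / 2) * ∑ z, ((∑ w : Fin M → A, (∏ m, p (w m)) *
            |1 / (M : ℝ) * ∑ m, f z (w m) - ∑ a, p a * f z a|) +
            (1 / (M : ℝ) * (∑ w : Fin M → A, (∏ m, p (w m)) * ∑ m, r z (w m)) +
              (∑ w : Fin M → A, ∏ m, p (w m)) * ∑ a, p a * r z a)) := by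
          have h1 : ∀ z, (∑ w : Fin M → A, (∏ m, p (w m)) *
            |1 / (M : ℝ) * ∑ m, f z (w m) - ∑ a, p a * f z a|) +
            (1 / (M : ℝ) * (∑ w : Fin M → A, (∏ m, p (w m)) * ∑ m, r z (w m)) +
              (∑ w : Fin M → A, ∏ m, p (w m)) * ∑ a, p a * r z a) =
            ∑ w : Fin M → A, (∏ m, p (w m)) *
              (|1 / (M : ℝ) * ∑ m, f z (w m) - ∑ a, p a * f z a| +
              (1 / (M : ℝ) * ∑ m, r z (w m) + ∑ a, p a * r z a)) := by
            intro z
            rw [Finset.mul_sum, Finset.sum_mul, ← Finset.sum_add_distrib,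
              ← Finset.sum_add_distrib]
            exact Finset.sum_congr rfl fun w _ => by ring
          simp only [h1]
          rw [Finset.sum_comm, Finset.mul_sum]
          refine Finset.sum_congr rfl fun w _ => ?_
          rw [← Finset.mul_sum]
          ring
      _ ≤ (1 / 2) * ∑ z, (Q z * T + 2 * ∑ a, p a * r z a) := by
          refine mul_le_mul_of_nonneg_left (Finset.sum_le_sum fun z _ => ?_) (by norm_num)
          have h1 := sum_prod_mul_abs_sub_le hp hM (hf0 z) hB (hfB z) (v := Q z)
            (Finset.sum_le_sum fun a _ => mul_le_mul_of_nonneg_left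
              (by rw [hfr z a]; linarith [hr0 z a]) (hp.1 a)) hκ
          rw [sum_prod_mul_sum hp.2, sum_prod_eq_one hp.2]
          have h2 : 1 / (M : ℝ) * (M * ∑ a, p a * r z a) = ∑ a, p a * r z a := by field_simp
          rw [h2]
          change _ ≤ Q z * T at h1
          linarith
      _ = T / 2 + E := by
          rw [Finset.sum_add_distrib, ← Finset.sum_mul, hQ1, ← Finset.mul_sum]
          ring
  by_contra! hcon
  have hlt : ∀ w : Fin M → A, T / 2 + E <
      tvDist (fun z => 1 / (M : ℝ) * ∑ m, V (w m) z) Q := fun w => by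
    refine lt_of_le_of_lt (le_of_eq ?_) (hcon w)
    simp only [T, hE, hr]
    ring
  have h1 : T / 2 + E = ∑ w : Fin M → A, (∏ m, p (w m)) * (T / 2 + E) := by
    rw [← Finset.sum_mul, sum_prod_eq_one hp.2, one_mul]
  rw [h1] at hmean
  -- A codebook of positive probability makes the averaged inequality strict.
  obtain ⟨w, -, hw⟩ := Finset.exists_ne_zero_of_sum_ne_zero
    (s := Finset.univ) (f := fun w : Fin M → A => ∏ m, p (w m))
    (by rw [sum_prod_eq_one hp.2]; exact one_ne_zero)
  refine absurd hmean (not_le.2 (Finset.sum_lt_sum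
    (fun w _ => mul_le_mul_of_nonneg_left (hlt w).le (hp0 w)) ⟨w, Finset.mem_univ w, ?_⟩))
  exact mul_lt_mul_of_pos_left (hlt w) (lt_of_le_of_ne (hp0 w) hw.symm)

end SoftCovering

/-! ### Random coding above Wyner's common information -/

section Achievability

open Real (log exp)

variable {X Y : Type*} [Fintype X] [Fintype Y]

theorem prod_sum_eq_sum_prod {W : Type*} [Fintype W] {n : ℕ} (f : Fin n → W → ℝ) :
    ∏ i, ∑ w, f i w = ∑ w : Fin n → W, ∏ i, f i (w i) := by
  rw [Finset.prod_univ_sum, Fintype.piFinset_univ]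

theorem pi_prod_mem_stdSimplex {α : Type*} [Fintype α] {n : ℕ} {f : Fin n → α → ℝ}
    (hf : ∀ i, f i ∈ stdSimplex ℝ α) :
    (fun x : Fin n → α => ∏ i, f i (x i)) ∈ stdSimplex ℝ (Fin n → α) :=
  ⟨fun _ => Finset.prod_nonneg fun i _ => (hf i).1 _, by
    rw [← prod_sum_eq_sum_prod]
    exact Finset.prod_eq_one fun i _ => (hf i).2⟩

/-- The kernels of a Markov chain `X - W - Y`. -/
theorem exists_kernels_of_isMarkovXWY {W : Type*} [Fintype W] {P : X × Y × W → ℝ}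
    (hP : P ∈ stdSimplex ℝ (X × Y × W)) (hM : IsMarkovXWY P) :
    ∃ (a : W → X → ℝ) (b : W → Y → ℝ), (∀ w, a w ∈ stdSimplex ℝ X) ∧
      (∀ w, b w ∈ stdSimplex ℝ Y) ∧ ∀ x y w, P (x, y, w) = margW P w * (a w x * b w y) := by
  classical
  obtain ⟨⟨x₀, y₀, -⟩⟩ : Nonempty (X × Y × W) := by
    by_contra h
    rw [not_nonempty_iff] at h
    have := hP.2
    simp at this
  have hnn : ∀ w, 0 ≤ margW P w := fun w =>
    Finset.sum_nonneg fun x _ => Finset.sum_nonneg fun y _ => hP.1 _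
  -- Point masses serve as defaults at null `w`, where the factorization is trivial but the kernels
  -- must still be distributions.
  refine ⟨fun w x => if margW P w = 0 then Pi.single (M := fun _ => ℝ) x₀ 1 x
      else margXW P x w / margW P w,
    fun w y => if margW P w = 0 then Pi.single (M := fun _ => ℝ) y₀ 1 y
      else margYW P y w / margW P w, fun w => ?_, fun w => ?_, fun x y w => ?_⟩
  · by_cases h : margW P w = 0
    · simp only [h, if_true]
      exact single_mem_stdSimplex ℝ x₀
    · simp only [h, if_false]
      refine ⟨fun x => div_nonneg (Finset.sum_nonneg fun y _ => hP.1 _) (hnn w), ?_⟩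
      rw [← Finset.sum_div]
      exact div_self h
  · by_cases h : margW P w = 0
    · simp only [h, if_true]
      exact single_mem_stdSimplex ℝ y₀
    · simp only [h, if_false]
      refine ⟨fun x => div_nonneg (Finset.sum_nonneg fun y _ => hP.1 _) (hnn w), ?_⟩
      rw [← Finset.sum_div]
      simp only [margYW]
      rw [Finset.sum_comm]
      exact div_self h
  · by_cases h : margW P w = 0
    · rw [h, zero_mul]
      rw [margW, ← Fintype.sum_prod_type' (f := fun x y => P (x, y, w))] at h
      exact (Finset.sum_eq_zero_iff_of_nonneg fun (z : X × Y) _ => hP.1 (z.1, z.2, w)).1 h (x, y)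
        (Finset.mem_univ _)
    · have := hM x y w
      simp only [h, if_false]
      field_simp
      linarith

/-- Chernoff's bound for the information density. -/
theorem sum_atypical_le {π : X × Y → ℝ} {k : ℕ} {P : X × Y × Fin k → ℝ}
    (hP : P ∈ stdSimplex ℝ (X × Y × Fin k)) (hm : ∀ x y, margXY P x y = π (x, y))
    {p : Fin k → ℝ} {V : Fin k → X × Y → ℝ} (hp : ∀ w, margW P w = p w) (hV : ∀ w z, 0 ≤ V w z)
    (hPV : ∀ x y w, P (x, y, w) = p w * V w (x, y)) {t A β : ℝ} (ht : 0 < t)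
    (hA : ∑ z, P z * exp (t * log (P z / (margXY P z.1 z.2.1 * margW P z.2.2))) ≤ exp (t * A))
    (n : ℕ) :
    ∑ z, ∑ w : Fin n → Fin k, (∏ i, p (w i)) *
      (if ∏ i, V (w i) (z.1 i, z.2 i) ≤ exp (n * β) * productDist π n z then 0
        else ∏ i, V (w i) (z.1 i, z.2 i)) ≤ exp (-(n * (t * (β - A)))) := by
  set ψ : X × Y × Fin k → ℝ := fun z => log (P z / (margXY P z.1 z.2.1 * margW P z.2.2)) with hψ
  have hp0 : ∀ w, 0 ≤ p w := fun w => by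
    rw [← hp]
    exact Finset.sum_nonneg fun x _ => Finset.sum_nonneg fun y _ => hP.1 _
  have hprod : ∀ (z : (Fin n → X) × (Fin n → Y)) (w : Fin n → Fin k),
      (∏ i, p (w i)) * ∏ i, V (w i) (z.1 i, z.2 i) = ∏ i, P (z.1 i, z.2 i, w i) := by
    intro z w
    rw [← Finset.prod_mul_distrib]
    exact Finset.prod_congr rfl fun i _ => (hPV _ _ _).symm
  have hP0 : ∀ (z : (Fin n → X) × (Fin n → Y)) (w : Fin n → Fin k),
      0 ≤ ∏ i, P (z.1 i, z.2 i, w i) := fun z w => Finset.prod_nonneg fun i _ => hP.1 _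
  -- Markov's exponential trick: where the term survives, the information densities sum to more than
  -- `n * β`, so the tilting factor is at least one.
  have key : ∀ (z : (Fin n → X) × (Fin n → Y)) (w : Fin n → Fin k), (∏ i, p (w i)) *
      (if ∏ i, V (w i) (z.1 i, z.2 i) ≤ exp (n * β) * productDist π n z then 0
        else ∏ i, V (w i) (z.1 i, z.2 i)) ≤
      exp (-(n * (t * β))) *
        ∏ i, P (z.1 i, z.2 i, w i) * exp (t * ψ (z.1 i, z.2 i, w i)) := by
    intro z w
    rw [Finset.prod_mul_distrib, ← Real.exp_sum, ← Finset.mul_sum]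
    split_ifs with hle
    · rw [mul_zero]
      exact mul_nonneg (Real.exp_pos _).le (mul_nonneg (hP0 z w) (Real.exp_pos _).le)
    rw [hprod]
    rcases (hP0 z w).eq_or_lt with h0 | h0
    · simp [← h0]
    have hne : ∀ i, P (z.1 i, z.2 i, w i) ≠ 0 := fun i hi =>
      h0.ne' (Finset.prod_eq_zero (Finset.mem_univ i) hi)
    have hπpos : ∀ i, 0 < π (z.1 i, z.2 i) := fun i => by
      rw [← hm]
      exact (lt_of_le_of_ne (hP.1 _) (hne i).symm).trans_le
        (Finset.single_le_sum (f := fun w => P (z.1 i, z.2 i, w)) (fun w _ => hP.1 _)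
          (Finset.mem_univ (w i)))
    have hVpos : ∀ i, 0 < V (w i) (z.1 i, z.2 i) := fun i =>
      lt_of_le_of_ne (hV _ _) fun h => hne i (by rw [hPV, ← h, mul_zero])
    have hppos : ∀ i, p (w i) ≠ 0 := fun i h => hne i (by rw [hPV, h, zero_mul])
    have hψi : ∀ i, ψ (z.1 i, z.2 i, w i) =
        log (V (w i) (z.1 i, z.2 i)) - log (π (z.1 i, z.2 i)) := fun i => by
      simp only [hψ]
      rw [hm, hp, hPV, ← Real.log_div (hVpos i).ne' (hπpos i).ne']
      congr 1
      have := hppos i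
      have := (hπpos i).ne'
      field_simp
    have hπn : 0 < productDist π n z := Finset.prod_pos fun i _ => hπpos i
    have hlog := Real.log_lt_log (by positivity) (not_le.1 hle)
    rw [Real.log_mul (Real.exp_pos _).ne' hπn.ne', Real.log_exp, productDist,
      Real.log_prod fun i _ => (hπpos i).ne', Real.log_prod fun i _ => (hVpos i).ne'] at hlog
    simp only [hψi, Finset.sum_sub_distrib]
    have h1 : 1 ≤ exp (-(n * (t * β))) * exp (t * (∑ i, log (V (w i) (z.1 i, z.2 i)) -
        ∑ i, log (π (z.1 i, z.2 i)))) := by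
      rw [← Real.exp_add]
      refine Real.one_le_exp ?_
      have := mul_le_mul_of_nonneg_left hlog.le ht.le
      linarith
    have := mul_le_mul_of_nonneg_left h1 h0.le
    linarith
  refine (Finset.sum_le_sum fun z _ => Finset.sum_le_sum fun w _ => key z w).trans ?_
  simp only [← Finset.mul_sum]
  have hsum : ∑ z : (Fin n → X) × (Fin n → Y), ∑ w : Fin n → Fin k,
      ∏ i, P (z.1 i, z.2 i, w i) * exp (t * ψ (z.1 i, z.2 i, w i)) =
      (∑ z, P z * exp (t * ψ z)) ^ n := by
    simp only [Fintype.sum_prod_type (f := fun z : X × Y × Fin k => P z * exp (t * ψ z)),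
      Fintype.sum_prod_type (γ := ℝ) (α₁ := Y)]
    rw [← Fintype.sum_prod_type' (f := fun x y => ∑ w, P (x, y, w) * exp (t * ψ (x, y, w))),
      ← sum_pi_prod_prod]
    refine Finset.sum_congr rfl fun z _ => ?_
    rw [prod_sum_eq_sum_prod]
  rw [hsum]
  calc exp (-(n * (t * β))) * (∑ z, P z * exp (t * ψ z)) ^ n
      ≤ exp (-(n * (t * β))) * exp (t * A) ^ n := by
        refine mul_le_mul_of_nonneg_left (pow_le_pow_left₀ (Finset.sum_nonneg fun z _ =>
          mul_nonneg (hP.1 z) (Real.exp_pos _).le) hA n) (Real.exp_pos _).le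
    _ = exp (-(n * (t * (β - A)))) := by
        rw [← Real.exp_nat_mul, ← Real.exp_add]
        congr 1
        ring

/-- Random coding: an explicit bound on the error of the best code of each block length. -/
theorem exists_code_tvError_le {π : X × Y → ℝ} (hπ : π ∈ stdSimplex ℝ (X × Y)) {η : ℝ}
    (hη : 0 < η) :
    ∃ t, 0 < t ∧ ∀ (n M : ℕ) (κ : ℝ), 0 < M → 0 < κ → ∃ c : SynthesisCode X Y n,
      c.numMessages = M ∧ c.tvError π ≤
        (exp (n * (wynerCI π + 2 * η)) / (M * κ) + κ) / 4 + exp (-(n * (t * η))) := by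
  obtain ⟨k, P, hP, hm, hMarkov, hI⟩ := (isLeast_wynerCI hπ).1
  obtain ⟨a, b, ha, hb, hPab⟩ := exists_kernels_of_isMarkovXWY hP hMarkov
  obtain ⟨t, ht, hA⟩ := exists_sum_mul_exp_le hP
    (fun z => log (P z / (margXY P z.1 z.2.1 * margW P z.2.2))) hη
  have hE : ∑ z : X × Y × Fin k, P z * log (P z / (margXY P z.1 z.2.1 * margW P z.2.2)) =
      wynerCI π := by
    rw [← hI]
    simp only [mutualInfoXYW, Fintype.sum_prod_type]
  rw [hE] at hA
  refine ⟨t, ht, fun n M κ hM hκ => ?_⟩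
  have hpW : margW P ∈ stdSimplex ℝ (Fin k) := by
    refine ⟨fun w => Finset.sum_nonneg fun x _ => Finset.sum_nonneg fun y _ => hP.1 _, ?_⟩
    rw [← hP.2]
    simp only [margW, Fintype.sum_prod_type]
    rw [Finset.sum_comm]
    exact Finset.sum_congr rfl fun x _ => Finset.sum_comm
  set p : (Fin n → Fin k) → ℝ := fun w => ∏ i, margW P (w i) with hpdef
  have hp : p ∈ stdSimplex ℝ (Fin n → Fin k) := pi_prod_mem_stdSimplex fun _ => hpW
  set u : (Fin n → Fin k) → (Fin n → X) → ℝ := fun w x => ∏ i, a (w i) (x i) with hu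
  set v : (Fin n → Fin k) → (Fin n → Y) → ℝ := fun w y => ∏ i, b (w i) (y i) with hv
  have hu1 : ∀ w, u w ∈ stdSimplex ℝ (Fin n → X) := fun w => pi_prod_mem_stdSimplex fun i => ha _
  have hv1 : ∀ w, v w ∈ stdSimplex ℝ (Fin n → Y) := fun w => pi_prod_mem_stdSimplex fun i => hb _
  set V : (Fin n → Fin k) → (Fin n → X) × (Fin n → Y) → ℝ :=
    fun w z => u w z.1 * v w z.2 with hVdef
  have hVprod : ∀ w z, V w z = ∏ i, a (w i) (z.1 i) * b (w i) (z.2 i) := fun w z => by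
    rw [Finset.prod_mul_distrib]
  have hV : ∀ w, V w ∈ stdSimplex ℝ ((Fin n → X) × (Fin n → Y)) := fun w =>
    ⟨fun z => mul_nonneg ((hu1 w).1 _) ((hv1 w).1 _), by
      rw [Fintype.sum_prod_type]
      simp only [hVdef, ← Finset.mul_sum, (hv1 w).2, mul_one, (hu1 w).2]⟩
  have hQ : ∀ z, ∑ w, p w * V w z = productDist π n z := fun z => by
    simp only [hVprod, hpdef, ← Finset.prod_mul_distrib]
    rw [← prod_sum_eq_sum_prod fun i w => margW P w * (a w (z.1 i) * b w (z.2 i))]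
    refine Finset.prod_congr rfl fun i _ => ?_
    rw [← hm, margXY]
    exact Finset.sum_congr rfl fun w _ => (hPab _ _ _).symm
  -- The threshold rate exceeds the moment bound `wynerCI π + η` by `η`, which yields the exponent
  -- `t * η`.
  obtain ⟨w, hw⟩ := exists_codebook_tvDist_le hp hV hM
    (Real.exp_pos (n * (wynerCI π + 2 * η))).le hκ
  refine ⟨⟨M, hM, fun m => u (w m), fun m => hu1 _, fun m => v (w m), fun m => hv1 _⟩, rfl, ?_⟩
  have hat := sum_atypical_le hP hm (p := margW P) (V := fun w z => a w z.1 * b w z.2)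
    (fun _ => rfl) (fun w z => mul_nonneg ((ha w).1 _) ((hb w).1 _)) hPab ht hA
    (β := wynerCI π + 2 * η) n
  rw [show wynerCI π + 2 * η - (wynerCI π + η) = η by ring] at hat
  simp only [hQ] at hw
  refine hw.trans (add_le_add_right ?_ _)
  refine le_trans (le_of_eq ?_) hat
  simp only [hVprod, hpdef]

/-- The floor is at least one, so rounding down costs at most a factor of two. -/
theorem half_exp_le_floor {x : ℝ} (hx : 0 ≤ x) :
    0 < ⌊exp x⌋₊ ∧ exp x / 2 ≤ (⌊exp x⌋₊ : ℝ) := by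
  have h1 : 0 < ⌊exp x⌋₊ := Nat.floor_pos.2 (Real.one_le_exp hx)
  have h2 := Nat.lt_floor_add_one (exp x)
  have h3 : (1 : ℝ) ≤ ⌊exp x⌋₊ := by exact_mod_cast h1
  exact ⟨h1, by linarith⟩

theorem eventually_mul_exp_le_exp {K δ δ' : ℝ} (hK : 0 < K) (h : δ' < δ) :
    ∀ᶠ n : ℕ in atTop, K * exp (-(n * δ)) ≤ exp (-(n * δ')) := by
  filter_upwards [eventually_ge_atTop ⌈log K / (δ - δ')⌉₊] with n hn
  have h1 := Nat.ceil_le.1 hn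
  rw [div_le_iff₀ (by linarith)] at h1
  rw [← Real.exp_log hK, ← Real.exp_add, Real.exp_le_exp]
  linarith

/-- Exponentially fast synthesis above Wyner's common information. -/
theorem exists_codes_tvError_le_exp {π : X × Y → ℝ} (hπ : π ∈ stdSimplex ℝ (X × Y)) {R : ℝ}
    (hR : wynerCI π < R) :
    ∃ c : (n : ℕ) → SynthesisCode X Y n, HasRate c R ∧ ∃ δ : ℝ, 0 < δ ∧ ∀ᶠ n : ℕ in atTop,
      (c n).tvError π ≤ exp (-(n * δ)) := by
  have hR0 : 0 < R := (wynerCI_nonneg hπ).trans_lt hR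
  obtain ⟨η, hη, hRη⟩ : ∃ η, 0 < η ∧ R = wynerCI π + 3 * η :=
    ⟨(R - wynerCI π) / 3, by linarith, by ring⟩
  obtain ⟨t, ht, hcode⟩ := exists_code_tvError_le hπ hη
  have hfloor : ∀ n : ℕ, 0 < ⌊exp (n * R)⌋₊ ∧ exp (n * R) / 2 ≤ (⌊exp (n * R)⌋₊ : ℝ) := fun n =>
    half_exp_le_floor (by positivity)
  -- The rate exceeds the threshold by `η`; taking `κ` with exponent `η / 2` balances the covering
  -- terms. All errors sum to at most `7/4` times `exp (-(n * δ))`, and halving `δ` absorbs the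
  -- constant.
  choose c hc1 hc2 using fun n : ℕ =>
    hcode n ⌊exp (n * R)⌋₊ (exp (-(n * (η / 2)))) (hfloor n).1 (Real.exp_pos _)
  refine ⟨c, hc1, min (η / 2) (t * η) / 2, by positivity, ?_⟩
  set δ := min (η / 2) (t * η) with hδ
  have hδ0 : 0 < δ := lt_min (by positivity) (by positivity)
  filter_upwards [eventually_mul_exp_le_exp (K := 2) two_pos (half_lt_self hδ0)] with n hn
  refine le_trans ((hc2 n).trans ?_) hn
  have hM : 0 < (⌊exp (n * R)⌋₊ : ℝ) := by exact_mod_cast (hfloor n).1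
  have h1 : exp (n * (wynerCI π + 2 * η)) / (⌊exp (n * R)⌋₊ * exp (-(n * (η / 2)))) ≤
      2 * exp (-(n * (η / 2))) := by
    rw [div_le_iff₀ (by positivity)]
    have h2 : exp (n * (wynerCI π + 2 * η)) =
        2 * exp (-(n * (η / 2))) * (exp (n * R) / 2 * exp (-(n * (η / 2)))) := by
      rw [hRη, show ∀ x y : ℝ, 2 * x * (y / 2 * x) = x * y * x from fun x y => by ring,
        ← Real.exp_add, ← Real.exp_add]
      congr 1
      ring
    rw [h2]
    have := (hfloor n).2
    gcongr
  have hn0 : (0 : ℝ) ≤ n := n.cast_nonneg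
  have h3 : exp (-(n * (η / 2))) ≤ exp (-(n * δ)) := Real.exp_le_exp.2 (by
    have := mul_le_mul_of_nonneg_left (min_le_left (η / 2) (t * η)) hn0
    linarith)
  have h4 : exp (-(n * (t * η))) ≤ exp (-(n * δ)) := Real.exp_le_exp.2 (by
    have := mul_le_mul_of_nonneg_left (min_le_right (η / 2) (t * η)) hn0
    linarith)
  have h5 := Real.exp_pos (-(n * δ))
  linarith

end Achievability

/-! ### The operational common information -/

section CommonInformation

open Real (log exp)

variable {X Y : Type*} [Fintype X] [Fintype Y]

theorem SynthesisCode.tvError_nonneg {n : ℕ} (c : SynthesisCode X Y n) (π : X × Y → ℝ) :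
    0 ≤ c.tvError π :=
  mul_nonneg (by norm_num) (Finset.sum_nonneg fun _ _ => abs_nonneg _)

theorem SynthesisCode.tvError_le_one {π : X × Y → ℝ} (hπ : π ∈ stdSimplex ℝ (X × Y)) {n : ℕ}
    (c : SynthesisCode X Y n) : c.tvError π ≤ 1 := by
  have hP := c.inducedDist_mem_stdSimplex
  have hπn := productDist_mem_stdSimplex hπ n
  rw [SynthesisCode.tvError, tvDist_eq_one_sub_sum_min hP hπn]
  have : 0 ≤ ∑ z, min (c.inducedDist z) (productDist π n z) :=
    Finset.sum_nonneg fun z _ => le_min (hP.1 z) (hπn.1 z)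
  linarith

theorem tendsto_exp_neg_natCast_mul {δ : ℝ} (hδ : 0 < δ) :
    Tendsto (fun n : ℕ => exp (-(n * δ))) atTop (nhds 0) :=
  Real.tendsto_exp_neg_atTop_nhds_zero.comp
    (tendsto_natCast_atTop_atTop.atTop_mul_const hδ)

theorem mem_achievableRatesTV_of_lt {π : X × Y → ℝ} (hπ : π ∈ stdSimplex ℝ (X × Y)) {R ε : ℝ}
    (hR : wynerCI π < R) (hε : 0 ≤ ε) : R ∈ achievableRatesTV π ε := by
  obtain ⟨c, hc, δ, hδ, hle⟩ := exists_codes_tvError_le_exp hπ hR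
  refine ⟨(wynerCI_nonneg hπ).trans_lt hR, c, hc, ?_⟩
  have := squeeze_zero' (Eventually.of_forall fun n => (c n).tvError_nonneg π) hle
    (tendsto_exp_neg_natCast_mul hδ)
  rw [this.limsup_eq]
  exact hε

/-- Below Wyner's value the error tends to one, so its limsup cannot be at most `ε < 1`. -/
theorem wynerCI_le_of_mem_achievableRatesTV {π : X × Y → ℝ} (hπ : π ∈ stdSimplex ℝ (X × Y))
    {R ε : ℝ} (hε : ε < 1) (hR : R ∈ achievableRatesTV π ε) : wynerCI π ≤ R := by
  obtain ⟨hR0, c, hc, hlim⟩ := hR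
  by_contra! hlt
  obtain ⟨δ, hδ, hbound⟩ := exists_one_sub_exp_le_tvError hπ hlt
  have hrate : ∀ᶠ n : ℕ in atTop, 1 - exp (-(n * δ)) ≤ (c n).tvError π := by
    filter_upwards [eventually_gt_atTop 0] with n hn
    refine hbound n (c n) hn ?_
    have hn' : (0 : ℝ) < n := by exact_mod_cast hn
    rw [div_le_iff₀ hn', hc n, mul_comm R, Real.log_le_iff_le_exp]
    · exact Nat.floor_le (Real.exp_pos _).le
    · exact_mod_cast (half_exp_le_floor (mul_pos hn' hR0).le).1
  have htend : Tendsto (fun n => (c n).tvError π) atTop (nhds 1) := by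
    refine tendsto_of_tendsto_of_tendsto_of_le_of_le' ?_ tendsto_const_nhds hrate
      (Eventually.of_forall fun n => (c n).tvError_le_one hπ)
    simpa using (tendsto_exp_neg_natCast_mul hδ).const_sub 1
  rw [htend.limsup_eq] at hlim
  linarith

theorem commonInfoTV_eq_wynerCI {π : X × Y → ℝ} (hπ : π ∈ stdSimplex ℝ (X × Y)) {ε : ℝ}
    (hε : ε ∈ Set.Ico (0 : ℝ) 1) : commonInfoTV π ε = wynerCI π := by
  have hlb : ∀ R ∈ achievableRatesTV π ε, wynerCI π ≤ R := fun R hR =>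
    wynerCI_le_of_mem_achievableRatesTV hπ hε.2 hR
  refine le_antisymm (le_of_forall_gt_imp_ge_of_dense fun R hR => ?_) ?_
  · exact csInf_le ⟨_, hlb⟩ (mem_achievableRatesTV_of_lt hπ hR hε.1)
  · exact le_csInf ⟨_, mem_achievableRatesTV_of_lt hπ (lt_add_one _) hε.1⟩ hlb

theorem commonInfoTV_one {π : X × Y → ℝ} (hπ : π ∈ stdSimplex ℝ (X × Y)) :
    commonInfoTV π 1 = 0 := by
  have hset : achievableRatesTV π 1 = Set.Ioi 0 := by
    refine Set.Subset.antisymm (fun R hR => hR.1) fun R hR => ⟨hR, ?_⟩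
    have hR0 : (0 : ℝ) < R := hR
    -- Only the existence of codes with the prescribed number of messages matters; the error bound
    -- is discarded, since the distance never exceeds one.
    obtain ⟨t, -, hcode⟩ := exists_code_tvError_le hπ one_pos
    choose c hc _ using fun n : ℕ => hcode n ⌊exp (n * R)⌋₊ 1
      (half_exp_le_floor (mul_nonneg n.cast_nonneg hR0.le)).1 one_pos
    refine ⟨c, hc, ?_⟩
    refine limsup_le_of_le ?_ (Eventually.of_forall fun n => (c n).tvError_le_one hπ)
    exact isCoboundedUnder_le_of_le atTop fun n => (c n).tvError_nonneg π
  rw [commonInfoTV, hset, csInf_Ioi]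

end CommonInformation

end

theorem theorem2 {X Y : Type*} [Fintype X] [Fintype Y]
    (π : X × Y → ℝ) (hπ : π ∈ stdSimplex ℝ (X × Y)) :
    -- the minimum that defines Wyner's common information is attained
    IsLeast (wynerValues π) (wynerCI π) ∧
    -- (i)
    ((∀ ε ∈ Set.Ico (0 : ℝ) 1, commonInfoTV π ε = wynerCI π) ∧
      commonInfoTV π 1 = 0 ∧
      StrongConverseTV π) ∧
    -- (ii)
    (∀ R : ℝ, wynerCI π < R →
      ∃ c : (n : ℕ) → SynthesisCode X Y n, HasRate c R ∧
        ∃ δ : ℝ, 0 < δ ∧ ∀ᶠ n : ℕ in atTop,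
          (c n).tvError π ≤ Real.exp (-(n * δ))) ∧
    -- (iii)
    (∀ R : ℝ, R < wynerCI π →
      ∀ c : (n : ℕ) → SynthesisCode X Y n,
        (∀ᶠ n : ℕ in atTop, Real.log ((c n).numMessages) / n ≤ R) →
        ∃ δ : ℝ, 0 < δ ∧ ∀ᶠ n : ℕ in atTop,
          1 - Real.exp (-(n * δ)) ≤ (c n).tvError π) := by
  refine ⟨isLeast_wynerCI hπ, ⟨fun ε hε => commonInfoTV_eq_wynerCI hπ hε, commonInfoTV_one hπ,
    fun ε hε ε' hε' => ?_⟩, fun R hR => exists_codes_tvError_le_exp hπ hR, fun R hR c hc => ?_⟩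
  · rw [commonInfoTV_eq_wynerCI hπ hε, commonInfoTV_eq_wynerCI hπ hε']
  · obtain ⟨δ, hδ, h⟩ := exists_one_sub_exp_le_tvError hπ hR
    refine ⟨δ, hδ, ?_⟩
    filter_upwards [hc, eventually_gt_atTop 0] with n hn hn0
    exact h n (c n) hn0 hn
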